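/- Let $N\ge 1$ and let $g:\mathbb R\to\mathbb R$ satisfy: $g\in C^{1,\sigma}_{\mathrm{loc}}(\mathbb R)$ for some $\sigma\in(0,1)$ (that is, $g\in C^1$ and $g'$ is $\sigma$-Hölder continuous on compact sets); $g$ is odd; $g'(0)>0$; and there is $\alpha_0\in(0,+\infty]$ such that $g>0$ on $(0,\alpha_0)$ and $g<0$ on $(\alpha_0,\infty)$. Put $G(z)=\int_0^z g(s)\,ds$. Then there is a family $(u_\alpha)_{|\alpha|<\alpha_0}$ of functions $u_\alpha\in C^2(\mathbb R^N)$ such that the set $\mathcal C=\{u_\alpha : |\alpha|<\alpha_0\}$ is connected in $C^2(\mathbb R^N)$ with respect to locally uniform convergence of the function and of its first and second derivatives and, if $N\ge2$, also with respect to uniform convergence on $\mathbb R^N$ of the function and of its first and second derivatives, and such that for every $\alpha$ with $|\alpha|<\alpha_0$ the function $u_\alpha$ is a radially symmetric classical solution of $-\Delta u=g(u)$ in $\mathbb R^N$, is oscillating (it has an unbounded sequence of zeros), and satisfies the following, where $u_\alpha(r)$, $r=|x|$, also denotes its radial profile and $'$ is the derivative in $r$: (i) $u_\alpha(0)=\alpha$;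 (ii) $\|u_\alpha\|_{L^\infty(\mathbb R^N)}=|\alpha|$ and $\|u_\alpha'\|_{L^\infty(\mathbb R^N)}\le\sqrt{2G(\alpha)}$. If $N=1$, every $u_\alpha$ is periodic. If $N\ge2$, every $u_\alpha$ is localized ($u_\alpha(x)\to0$ as $|x|\to\infty$), and (iii) for every $\alpha$ with $0<|\alpha|<\alpha_0$ there are constants $c_\alpha,C_\alpha>0$ such that $$c_\alpha r^{(1-N)/2}\le |u_\alpha(r)|+|u_\alpha'(r)|+|u_\alpha''(r)|\le C_\alpha r^{(1-N)/2}\qquad\text{for all } r\ge1.$$ -/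

import Mathlib

open Set Filter Topology MeasureTheory
open scoped NNReal ENNReal InnerProductSpace

noncomputable section

namespace Helmholtz

/-- Euclidean space `ℝ^N`. -/
abbrev E (N : ℕ) : Type := EuclideanSpace ℝ (Fin N)

/-- `g ∈ C^{1,σ}(ℝ)`: `g` is continuously differentiable and its derivative is Hölder continuous
with exponent `σ` on every compact set. (No bound at infinity, so that for instance
`z ↦ k² z + |z|^{p-2} z` is allowed.) -/
def IsC1Holder (σ : ℝ≥0) (g : ℝ → ℝ) : Prop :=
  ContDiff ℝ 1 g ∧ ∀ K : Set ℝ, IsCompact K → ∃ C : ℝ≥0, HolderOnWith C σ (deriv g) K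

/-- The primitive `G(z) = ∫₀^z g(s) ds`. -/
def primitive (g : ℝ → ℝ) (z : ℝ) : ℝ := ∫ s in (0 : ℝ)..z, g s

/-- The space `C²(ℝ^N)` of twice continuously differentiable real functions. -/
def C2 (N : ℕ) : Type := {u : E N → ℝ // ContDiff ℝ 2 u}

instance (N : ℕ) : CoeFun (C2 N) (fun _ => E N → ℝ) := ⟨Subtype.val⟩

/-- The topology on `C²(ℝ^N)` of uniform convergence, on every member of the family `S` of sets,
of the functions and of their first and second derivatives. -/
@[reducible] def c2Topology (N : ℕ) (S : Set (Set (E N))) : TopologicalSpace (C2 N) :=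
  TopologicalSpace.induced (fun u : C2 N => UniformOnFun.ofFun S (u : E N → ℝ)) inferInstance ⊓
  TopologicalSpace.induced (fun u : C2 N => UniformOnFun.ofFun S (fderiv ℝ u)) inferInstance ⊓
  TopologicalSpace.induced (fun u : C2 N => UniformOnFun.ofFun S (fderiv ℝ (fderiv ℝ u)))
    inferInstance

/-- `A` is connected in `C²(ℝ^N)` for convergence of the function and of its first and second
derivatives, uniformly on compact sets. -/
def IsLocallyUniformContinuum {N : ℕ} (A : Set (C2 N)) : Prop :=
  @IsConnected (C2 N) (c2Topology N {K | IsCompact K}) A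

/-- `A` is connected in `C²(ℝ^N)` for convergence of the function and of its first and second
derivatives, uniformly on the whole of `ℝ^N`. -/
def IsUniformContinuum {N : ℕ} (A : Set (C2 N)) : Prop :=
  @IsConnected (C2 N) (c2Topology N {Set.univ}) A

/-- `u` is a classical solution of `-Δu = g(u)` in `ℝ^N`. -/
def IsSolution {N : ℕ} (g : ℝ → ℝ) (u : C2 N) : Prop :=
  ∀ x : E N, -(Laplacian.laplacian (u : E N → ℝ) x) = g (u x)

/-- `u` is radially symmetric. -/
def IsRadial {N : ℕ} (u : C2 N) : Prop :=
  ∀ x y : E N, ‖x‖ = ‖y‖ → u x = u y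

/-- `u` has an unbounded sequence of zeros. -/
def IsOscillating {N : ℕ} (u : C2 N) : Prop :=
  ∃ x : ℕ → E N, (∀ n, u (x n) = 0) ∧ ¬ Bornology.IsBounded (Set.range x)

/-- `u` converges to zero at infinity. -/
def IsLocalized {N : ℕ} (u : C2 N) : Prop :=
  Tendsto (u : E N → ℝ) (cocompact (E N)) (𝓝 0)

/-- The radial profile `r ↦ u(r e₁)` of `u`. It is defined (and twice continuously differentiable)
for all real `r`; if `u` is radially symmetric, then `u x = profile u ‖x‖`. -/
def profile {N : ℕ} [NeZero N] (u : C2 N) (r : ℝ) : ℝ :=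
  u (EuclideanSpace.single (0 : Fin N) r)

end Helmholtz

end

/-! Write `n = N - 1`. A radial solution has a profile with `u'' + (n/r) u' + g(u) = 0`. Integrating
`(rⁿ u')' = -rⁿ g(u)` from `0` gives `u' = -r m(r)`, where `m` is a weighted mean of `g ∘ u` on `[0,
r]`; the singularity at the origin is gone, and shooting from `u(0) = α` becomes a fixed-point
problem.

The energy `E = u'²/2 + G(u)` satisfies `E' = -(n/r) u'²`, so `G(u) ≤ G(α)`. Since `G` increases on
`[0, |α|]`, the profile never leaves `[-|α|, |α|]`. Hence `g` may be truncated outside that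
interval, which gives global existence, the sup norm and the gradient bound. On the interval `a z² ≤
z g(z) ≤ b z²` with `a > 0`: the equation is a damped oscillator whose phase turns at a positive
rate, so zeros recur. For `n = 0`, reflection in a zero combined with evenness gives a period.

For decay, damping acts on `u'²` only, but on average kinetic and potential parts balance. Adding
`(n/(2r)) u u'` to `E` (`hasDerivAt_corrected`) spreads the damping over both, and yields first some
rate `E ≤ K r^(-δ)`. Hölder continuity of `g'` then gives `|2G(u) - u g(u)| ≤ C |u|^(2+σ)`, so the
corrected energy times `rⁿ` has logarithmic derivative `O(r^(-1-ε))`, which is integrable. Thus `rⁿ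
E` stays between positive constants (`exists_pow_mul_energy_bounds`).

Finally, the family is the image of an interval under `α ↦ u_α`. Continuity is locally uniform by an
exponentially weighted estimate, and uniform for `N ≥ 2` because an energy that is small at one
radius stays small beyond it (`exists_tail_bound`). -/

noncomputable section

namespace Helmholtz

/-! ### Radial averages and the inverse of the radial Laplacian -/

/-- The weighted mean `∫₀¹ tⁿ h(rt) dt = r^{-n-1} ∫₀^r sⁿ h(s) ds`. -/
def radialMean (n : ℕ) (h : ℝ → ℝ) (r : ℝ) : ℝ := ∫ t in (0 : ℝ)..1, t ^ n * h (r * t)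

/-- The solution `P` of `P'' + (n/r) P' = h`, `P(0) = P'(0) = 0`. -/
def radialPotential (n : ℕ) (h : ℝ → ℝ) (r : ℝ) : ℝ := ∫ s in (0 : ℝ)..r, s * radialMean n h s

theorem continuous_radialMean (n : ℕ) {h : ℝ → ℝ} (hh : Continuous h) :
    Continuous (radialMean n h) := by
  unfold radialMean
  apply intervalIntegral.continuous_parametric_intervalIntegral_of_continuous'
  fun_prop

theorem pow_mul_radialMean (n : ℕ) (h : ℝ → ℝ) (r : ℝ) :
    r ^ (n + 1) * radialMean n h r = ∫ s in (0 : ℝ)..r, s ^ n * h s := by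
  have := intervalIntegral.smul_integral_comp_mul_left (a := 0) (b := 1)
    (f := fun s : ℝ => s ^ n * h s) r
  simp only [smul_eq_mul, mul_zero, mul_one] at this
  rw [← this, radialMean, pow_succ, mul_comm (r ^ n), mul_assoc,
    ← intervalIntegral.integral_const_mul]
  congr 2
  ext t
  ring

theorem radialMean_zero (n : ℕ) (h : ℝ → ℝ) : radialMean n h 0 = h 0 / (n + 1) := by
  simp [radialMean, integral_pow, div_eq_inv_mul]

theorem hasDerivAt_radialMean (n : ℕ) {h : ℝ → ℝ} (hh : Continuous h) {r : ℝ} (hr : r ≠ 0) :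
    HasDerivAt (radialMean n h) ((h r - (n + 1) * radialMean n h r) / r) r := by
  have h1 : HasDerivAt (fun x => ∫ s in (0 : ℝ)..x, s ^ n * h s) (r ^ n * h r) r :=
    (by fun_prop : Continuous fun s : ℝ => s ^ n * h s).integral_hasStrictDerivAt 0 r |>.hasDerivAt
  have h2 : HasDerivAt (fun x : ℝ => x ^ (n + 1)) ((n + 1 : ℕ) * r ^ n) r := by
    simpa using hasDerivAt_pow (n + 1) r
  have h3 := h1.div h2 (pow_ne_zero _ hr)
  have h4 : radialMean n h =ᶠ[𝓝 r]
      ((fun x => ∫ s in (0 : ℝ)..x, s ^ n * h s) / fun x : ℝ => x ^ (n + 1)) := by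
    filter_upwards [isOpen_ne.mem_nhds hr] with x hx
    have hx' : x ^ (n + 1) ≠ 0 := pow_ne_zero _ hx
    rw [Pi.div_apply, ← pow_mul_radialMean, mul_div_cancel_left₀ _ hx']
  refine (h3.congr_of_eventuallyEq h4).congr_deriv ?_
  rw [← pow_mul_radialMean]
  push_cast
  field_simp
  ring

/-- The factor `r` restores differentiability at the origin, where the mean is only known to be
continuous. The value `h 0 / (n + 1)` there makes the formula agree on both cases, so profiles have
a second derivative everywhere. -/
theorem hasDerivAt_mul_radialMean (n : ℕ) {h : ℝ → ℝ} (hh : Continuous h) (r : ℝ) :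
    HasDerivAt (fun r => r * radialMean n h r) (h r - n * radialMean n h r) r := by
  rcases eq_or_ne r 0 with rfl | hr
  · have h1 : HasDerivAt (fun r => r * radialMean n h r) (radialMean n h 0) 0 := by
      rw [hasDerivAt_iff_tendsto_slope]
      have h2 : Tendsto (radialMean n h) (𝓝[≠] 0) (𝓝 (radialMean n h 0)) :=
        ((continuous_radialMean n hh).tendsto 0).mono_left nhdsWithin_le_nhds
      refine h2.congr' ?_
      filter_upwards [self_mem_nhdsWithin] with x hx
      have hx' : x ≠ 0 := hx
      simp only [slope_def_field, zero_mul, sub_zero]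
      field_simp
    refine h1.congr_deriv ?_
    rw [radialMean_zero]
    field_simp
    ring
  · refine ((hasDerivAt_id r).mul (hasDerivAt_radialMean n hh hr)).congr_deriv ?_
    simp only [id_eq]
    field_simp
    ring

theorem radialMean_even (n : ℕ) {h : ℝ → ℝ} (hh : ∀ r, h (-r) = h r) (r : ℝ) :
    radialMean n h (-r) = radialMean n h r := by
  simp [radialMean, hh]

theorem radialMean_sub (n : ℕ) {h k : ℝ → ℝ} (hh : Continuous h) (hk : Continuous k) (r : ℝ) :
    radialMean n (fun s => h s - k s) r = radialMean n h r - radialMean n k r := by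
  unfold radialMean
  rw [← intervalIntegral.integral_sub]
  · simp only [mul_sub]
  · exact (by fun_prop : Continuous fun t : ℝ => t ^ n * h (r * t)).intervalIntegrable _ _
  · exact (by fun_prop : Continuous fun t : ℝ => t ^ n * k (r * t)).intervalIntegrable _ _

theorem abs_radialMean_le_integral (n : ℕ) {h k : ℝ → ℝ} (hk : Continuous k) {r : ℝ}
    (hr : 0 ≤ r) (hb : ∀ s, 0 ≤ s → s ≤ r → |h s| ≤ k s) :
    |radialMean n h r| ≤ ∫ t in (0 : ℝ)..1, k (r * t) := by
  unfold radialMean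
  rw [← Real.norm_eq_abs]
  apply intervalIntegral.norm_integral_le_of_norm_le zero_le_one
  · refine Eventually.of_forall fun t ht => ?_
    rw [Real.norm_eq_abs, abs_mul, abs_pow, abs_of_pos ht.1]
    have h1 := hb (r * t) (mul_nonneg hr ht.1.le) (mul_le_of_le_one_right hr ht.2)
    calc t ^ n * |h (r * t)| ≤ 1 * |h (r * t)| := by
          gcongr
          exact pow_le_one₀ ht.1.le ht.2
      _ ≤ k (r * t) := by linarith
  · exact (by fun_prop : Continuous fun t : ℝ => k (r * t)).intervalIntegrable _ _

theorem abs_radialMean_le (n : ℕ) {h : ℝ → ℝ} {K r : ℝ}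
    (hr : 0 ≤ r) (hb : ∀ s, 0 ≤ s → s ≤ r → |h s| ≤ K) :
    |radialMean n h r| ≤ K := by
  simpa using abs_radialMean_le_integral n (k := fun _ => K) continuous_const hr hb

theorem continuous_radialPotential (n : ℕ) {h : ℝ → ℝ} (hh : Continuous h) :
    Continuous (radialPotential n h) := by
  have := continuous_radialMean n hh
  exact intervalIntegral.continuous_primitive
    (fun a b => (by fun_prop : Continuous fun s => s * radialMean n h s).intervalIntegrable a b) 0

theorem hasDerivAt_radialPotential (n : ℕ) {h : ℝ → ℝ} (hh : Continuous h) (r : ℝ) :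
    HasDerivAt (radialPotential n h) (r * radialMean n h r) r := by
  have := continuous_radialMean n hh
  exact ((by fun_prop : Continuous fun s => s * radialMean n h s).integral_hasStrictDerivAt
    0 r).hasDerivAt

theorem radialPotential_zero (n : ℕ) (h : ℝ → ℝ) : radialPotential n h 0 = 0 := by
  simp [radialPotential]

theorem radialPotential_even (n : ℕ) {h : ℝ → ℝ} (hh : ∀ r, h (-r) = h r) (r : ℝ) :
    radialPotential n h (-r) = radialPotential n h r := by
  unfold radialPotential
  have := intervalIntegral.integral_comp_neg (a := 0) (b := r)
    (f := fun s => s * radialMean n h s)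
  simp only [radialMean_even n hh, neg_zero, neg_mul, intervalIntegral.integral_neg] at this
  rw [intervalIntegral.integral_symm, ← this, neg_neg]

theorem radialPotential_sub (n : ℕ) {h k : ℝ → ℝ} (hh : Continuous h) (hk : Continuous k) (r : ℝ) :
    radialPotential n (fun s => h s - k s) r = radialPotential n h r - radialPotential n k r := by
  unfold radialPotential
  have h1 := continuous_radialMean n hh
  have h2 := continuous_radialMean n hk
  rw [← intervalIntegral.integral_sub]
  · simp only [radialMean_sub n hh hk, mul_sub]
  · exact (by fun_prop : Continuous fun s => s * radialMean n h s).intervalIntegrable _ _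
  · exact (by fun_prop : Continuous fun s => s * radialMean n k s).intervalIntegrable _ _

/-- After discarding `tⁿ ≤ 1`, two integrations remain, and each gains a factor `1 / l` against the
exponential. A large `l` therefore makes the potential a contraction. -/
theorem abs_radialPotential_le (n : ℕ) {h : ℝ → ℝ} {K l R : ℝ} (hl : 0 < l) (hK : 0 ≤ K)
    (hR : 0 ≤ R) (hb : ∀ s, 0 ≤ s → s ≤ R → |h s| ≤ K * Real.exp (l * s)) :
    |radialPotential n h R| ≤ K / l ^ 2 * Real.exp (l * R) := by
  have hd : ∀ c s : ℝ, HasDerivAt (fun s => c / l * Real.exp (l * s)) (c * Real.exp (l * s)) s := by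
    intro c s
    have := (((hasDerivAt_id s).const_mul l).exp).const_mul (c / l)
    refine this.congr_deriv ?_
    simp only [id]
    field_simp
  have hint : ∀ c s : ℝ,
      ∫ x in (0 : ℝ)..s, c * Real.exp (l * x) = c / l * Real.exp (l * s) - c / l := by
    intro c s
    rw [intervalIntegral.integral_eq_sub_of_hasDerivAt (fun x _ => hd c x)
      ((by fun_prop : Continuous fun x : ℝ => c * Real.exp (l * x)).intervalIntegrable _ _)]
    simp
  have hm : ∀ s, 0 ≤ s → s ≤ R → |s * radialMean n h s| ≤ K / l * Real.exp (l * s) := by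
    intro s hs hsR
    have h1 := abs_radialMean_le_integral n (k := fun s => K * Real.exp (l * s)) (by fun_prop) hs
      (fun x hx hxs => hb x hx (hxs.trans hsR))
    have h2 := intervalIntegral.smul_integral_comp_mul_left (a := 0) (b := 1)
      (f := fun s : ℝ => K * Real.exp (l * s)) s
    simp only [smul_eq_mul, mul_zero, mul_one, hint] at h2
    rw [abs_mul, abs_of_nonneg hs]
    have : 0 ≤ K / l := by positivity
    nlinarith [mul_le_mul_of_nonneg_left h1 hs]
  unfold radialPotential
  rw [← Real.norm_eq_abs]
  refine (intervalIntegral.norm_integral_le_of_norm_le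
    (g := fun s => K / l * Real.exp (l * s)) hR ?_ ?_).trans ?_
  · exact Eventually.of_forall fun s hs => by simpa using hm s hs.1.le hs.2
  · exact (by fun_prop : Continuous fun x : ℝ => K / l * Real.exp (l * x)).intervalIntegrable _ _
  · rw [hint, div_div, ← sq]
    have : 0 ≤ K / l ^ 2 := by positivity
    linarith

/-! ### Existence of profiles and dependence on the central value -/

/-- `u` is the profile of the radial solution of `-Δu = g(u)` in `ℝⁿ⁺¹` with `u(0) = α`. -/
structure IsRadialProfile (n : ℕ) (g : ℝ → ℝ) (α : ℝ) (u : ℝ → ℝ) : Prop where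
  zero : u 0 = α
  hasDerivAt : ∀ r, HasDerivAt u (-(r * radialMean n (g ∘ u) r)) r
  even : ∀ r, u (-r) = u r

/-- Banach's fixed point theorem for `ψ = e^(-l|r|) u` in the bounded continuous functions: the
weight gives a solution on the whole line at once, without continuation. -/
theorem exists_isRadialProfile (n : ℕ) {g : ℝ → ℝ} {L B : ℝ} (hL : 0 ≤ L)
    (hLip : ∀ x y, |g x - g y| ≤ L * |x - y|) (hB : ∀ x, |g x| ≤ B) (α : ℝ) :
    ∃ u, IsRadialProfile n g α u := by
  have hg : Continuous g := by
    refine (LipschitzWith.of_dist_le_mul (K := L.toNNReal) fun x y => ?_).continuous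
    simpa [Real.dist_eq, hL] using hLip x y
  have hB0 : 0 ≤ B := (abs_nonneg _).trans (hB 0)
  -- Any `l` with `l² ≥ 2L` gives contraction constant `1/2`.
  set l : ℝ := 2 * L + 1 with hl
  have hl0 : 0 < l := by positivity
  have hl2 : L / l ^ 2 ≤ 1 / 2 := by
    rw [div_le_div_iff₀ (by positivity) two_pos]
    nlinarith
  let w : BoundedContinuousFunction ℝ ℝ → ℝ → ℝ := fun ψ s => Real.exp (l * |s|) * ψ s
  have hw : ∀ ψ, Continuous (w ψ) := fun ψ => by
    have := ψ.continuous
    fun_prop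
  let T0 : BoundedContinuousFunction ℝ ℝ → ℝ → ℝ := fun ψ r =>
    Real.exp (-(l * |r|)) * (α - radialPotential n (g ∘ w ψ) |r|)
  have hT0c : ∀ ψ, Continuous (T0 ψ) := fun ψ => by
    have := continuous_radialPotential n (hg.comp (hw ψ))
    fun_prop
  have hT0b : ∀ ψ r, ‖T0 ψ r‖ ≤ |α| + B / l ^ 2 := by
    intro ψ r
    have h1 : |radialPotential n (g ∘ w ψ) (|r|)| ≤ B / l ^ 2 * Real.exp (l * |r|) := by
      refine abs_radialPotential_le n hl0 hB0 (abs_nonneg r) fun s hs _ => ?_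
      refine (hB _).trans (le_mul_of_one_le_right hB0 (Real.one_le_exp (by positivity)))
    have h2 : Real.exp (-(l * |r|)) * Real.exp (l * |r|) = 1 := by rw [← Real.exp_add]; simp
    have h3 : Real.exp (-(l * |r|)) ≤ 1 := Real.exp_le_one_iff.2 (by simp; positivity)
    have h4 := Real.exp_pos (-(l * |r|))
    rw [Real.norm_eq_abs, abs_mul, abs_of_pos h4]
    calc _ ≤ Real.exp (-(l * |r|)) * (|α| + B / l ^ 2 * Real.exp (l * |r|)) := by
          gcongr
          exact (abs_sub _ _).trans (by gcongr)
      _ = Real.exp (-(l * |r|)) * |α| + B / l ^ 2 *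
          (Real.exp (-(l * |r|)) * Real.exp (l * |r|)) := by ring
      _ ≤ _ := by
          rw [h2]
          nlinarith [abs_nonneg α]
  let T : BoundedContinuousFunction ℝ ℝ → BoundedContinuousFunction ℝ ℝ := fun ψ =>
    BoundedContinuousFunction.ofNormedAddCommGroup (T0 ψ) (hT0c ψ) _ (hT0b ψ)
  have hT : ContractingWith (1 / 2) T := by
    refine ⟨by rw [← NNReal.coe_lt_coe]; norm_num, LipschitzWith.of_dist_le_mul fun ψ φ => ?_⟩
    rw [BoundedContinuousFunction.dist_le (by positivity)]
    intro r
    have h1 : |radialPotential n (fun s => (g ∘ w ψ) s - (g ∘ w φ) s) (|r|)|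
        ≤ L * dist ψ φ / l ^ 2 * Real.exp (l * |r|) := by
      refine abs_radialPotential_le n hl0 (by positivity) (abs_nonneg r) fun s hs _ => ?_
      refine (hLip _ _).trans ?_
      have h5 : w ψ s - w φ s = Real.exp (l * s) * (ψ s - φ s) := by
        simp only [w, abs_of_nonneg hs]
        ring
      rw [h5, abs_mul, abs_of_pos (Real.exp_pos _)]
      have h6 : |ψ s - φ s| ≤ dist ψ φ := by
        rw [← Real.dist_eq]
        exact BoundedContinuousFunction.dist_coe_le_dist s
      calc _ ≤ L * (Real.exp (l * s) * dist ψ φ) := by gcongr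
        _ = _ := by ring
    rw [radialPotential_sub n (hg.comp (hw ψ)) (hg.comp (hw φ))] at h1
    have h2 : Real.exp (-(l * |r|)) * Real.exp (l * |r|) = 1 := by rw [← Real.exp_add]; simp
    have h7 : T ψ r - T φ r = -(Real.exp (-(l * |r|)) *
        (radialPotential n (g ∘ w ψ) |r| - radialPotential n (g ∘ w φ) |r|)) := by
      change T0 ψ r - T0 φ r = _
      simp only [T0]
      ring
    rw [Real.dist_eq, h7, abs_neg, abs_mul, abs_of_pos (Real.exp_pos _)]
    calc _ ≤ Real.exp (-(l * |r|)) * (L * dist ψ φ / l ^ 2 * Real.exp (l * |r|)) := by gcongr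
      _ = L / l ^ 2 * dist ψ φ * (Real.exp (-(l * |r|)) * Real.exp (l * |r|)) := by ring
      _ ≤ _ := by
        rw [h2, mul_one]
        push_cast
        gcongr
  obtain ⟨ψ, hψ⟩ : ∃ ψ, T ψ = ψ := ⟨_, hT.fixedPoint_isFixedPt⟩
  have hfix : ∀ r, w ψ r = α - radialPotential n (g ∘ w ψ) |r| := by
    intro r
    have h1 : T0 ψ r = ψ r := DFunLike.congr_fun hψ r
    have h2 : Real.exp (l * |r|) * Real.exp (-(l * |r|)) = 1 := by rw [← Real.exp_add]; simp
    change Real.exp (l * |r|) * ψ r = _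
    rw [← h1]
    simp only [T0]
    rw [← mul_assoc, h2, one_mul]
  have heven : ∀ r, w ψ (-r) = w ψ r := fun r => by rw [hfix, hfix r, abs_neg]
  -- Evenness removes the absolute value, so the identity can be differentiated across `0`.
  have hfix' : w ψ = fun r => α - radialPotential n (g ∘ w ψ) r := by
    ext r
    rw [hfix]
    rcases abs_choice r with h | h <;> rw [h]
    rw [radialPotential_even n (fun s => by simp [heven])]
  refine ⟨w ψ, ⟨by rw [hfix]; simp [radialPotential_zero], fun r => ?_, heven⟩⟩
  have := (hasDerivAt_radialPotential n (hg.comp (hw ψ)) r).const_sub α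
  rwa [← hfix'] at this

namespace IsRadialProfile

variable {n : ℕ} {g : ℝ → ℝ} {α : ℝ} {u : ℝ → ℝ}

theorem continuous (hu : IsRadialProfile n g α u) : Continuous u :=
  continuous_iff_continuousAt.2 fun r => (hu.hasDerivAt r).continuousAt

theorem eq_sub_radialPotential (hu : IsRadialProfile n g α u) (hg : Continuous g) (r : ℝ) :
    u r = α - radialPotential n (g ∘ u) r := by
  have hd : ∀ x, HasDerivAt (fun r => u r + radialPotential n (g ∘ u) r) 0 x := fun x =>
    ((hu.hasDerivAt x).add (hasDerivAt_radialPotential n (hg.comp hu.continuous) x)).congr_deriv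
      (by ring)
  have := is_const_of_deriv_eq_zero (fun x => (hd x).differentiableAt) (fun x => (hd x).deriv) r 0
  simp only [radialPotential_zero, hu.zero] at this
  linarith

/-- The same weight replaces Gronwall's inequality: at a maximum point of `e^(-ls) |u - v|` on `[0,
r]`, the integral term is at most half the maximum and is absorbed. -/
theorem abs_sub_le {β A L l : ℝ} {v : ℝ → ℝ} (hu : IsRadialProfile n g α u)
    (hv : IsRadialProfile n g β v) (hg : Continuous g) (hL : 0 ≤ L) (hl : 0 < l)
    (hLl : L / l ^ 2 ≤ 1 / 2)
    (hLip : ∀ x y, |x| ≤ A → |y| ≤ A → |g x - g y| ≤ L * |x - y|)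
    (hub : ∀ r, |u r| ≤ A) (hvb : ∀ r, |v r| ≤ A) {r : ℝ} (hr : 0 ≤ r) :
    |u r - v r| ≤ 2 * |α - β| * Real.exp (l * r) := by
  have hcu := hu.continuous
  have hcv := hv.continuous
  obtain ⟨s₀, hs₀, hmax⟩ := isCompact_Icc.exists_isMaxOn (nonempty_Icc.2 hr)
    (f := fun s => Real.exp (-(l * s)) * |u s - v s|)
    (by fun_prop : Continuous fun s => Real.exp (-(l * s)) * |u s - v s|).continuousOn
  set M := Real.exp (-(l * s₀)) * |u s₀ - v s₀| with hM
  have hM0 : 0 ≤ M := by positivity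
  have hexp : ∀ s, Real.exp (l * s) * Real.exp (-(l * s)) = 1 := fun s => by
    rw [← Real.exp_add]; simp
  have hb : ∀ s, 0 ≤ s → s ≤ r → |u s - v s| ≤ M * Real.exp (l * s) := by
    intro s h0 h1
    have h2 : Real.exp (-(l * s)) * |u s - v s| ≤ M := hmax ⟨h0, h1⟩
    calc |u s - v s| = Real.exp (l * s) * Real.exp (-(l * s)) * |u s - v s| := by
          rw [hexp, one_mul]
      _ = Real.exp (l * s) * (Real.exp (-(l * s)) * |u s - v s|) := by ring
      _ ≤ Real.exp (l * s) * M := by gcongr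
      _ = _ := mul_comm _ _
  have hP : |radialPotential n (fun s => (g ∘ u) s - (g ∘ v) s) s₀|
      ≤ L * M / l ^ 2 * Real.exp (l * s₀) := by
    refine abs_radialPotential_le n hl (by positivity) hs₀.1 fun s h0 h1 => ?_
    calc _ ≤ L * |u s - v s| := hLip _ _ (hub s) (hvb s)
      _ ≤ L * (M * Real.exp (l * s)) := by
        gcongr
        exact hb s h0 (h1.trans hs₀.2)
      _ = _ := by ring
  rw [radialPotential_sub n (hg.comp hcu) (hg.comp hcv)] at hP
  have h3 : |u s₀ - v s₀| ≤ |α - β| + L * M / l ^ 2 * Real.exp (l * s₀) := by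
    rw [hu.eq_sub_radialPotential hg, hv.eq_sub_radialPotential hg, sub_sub_sub_comm]
    exact (abs_sub _ _).trans (by gcongr)
  have h4 : Real.exp (-(l * s₀)) ≤ 1 :=
    Real.exp_le_one_iff.2 (by have := mul_nonneg hl.le hs₀.1; linarith)
  have h5 : M ≤ |α - β| + L * M / l ^ 2 := by
    calc M ≤ Real.exp (-(l * s₀)) * (|α - β| + L * M / l ^ 2 * Real.exp (l * s₀)) := by
          rw [hM]; gcongr
      _ = Real.exp (-(l * s₀)) * |α - β| +
          L * M / l ^ 2 * (Real.exp (l * s₀) * Real.exp (-(l * s₀))) := by ring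
      _ ≤ _ := by
          rw [hexp, mul_one]
          nlinarith [abs_nonneg (α - β)]
  have h6 : L * M / l ^ 2 ≤ 1 / 2 * M := by
    rw [mul_div_right_comm]
    gcongr
  refine (hb r hr le_rfl).trans ?_
  gcongr
  linarith

theorem hasDerivAt_deriv (hu : IsRadialProfile n g α u) (hg : Continuous g) (r : ℝ) :
    HasDerivAt (fun r => -(r * radialMean n (g ∘ u) r))
      (n * radialMean n (g ∘ u) r - g (u r)) r :=
  (hasDerivAt_mul_radialMean n (hg.comp hu.continuous) r).neg.congr_deriv (by simp)

theorem deriv_eq (hu : IsRadialProfile n g α u) :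
    deriv u = fun r => -(r * radialMean n (g ∘ u) r) := funext fun r => (hu.hasDerivAt r).deriv

end IsRadialProfile

/-! ### The nonlinearity and its primitive compared with linear and quadratic functions -/

theorem hasDerivAt_primitive {g : ℝ → ℝ} (hg : Continuous g) (z : ℝ) :
    HasDerivAt (primitive g) (g z) z :=
  (hg.integral_hasStrictDerivAt 0 z).hasDerivAt

theorem primitive_zero (g : ℝ → ℝ) : primitive g 0 = 0 := by simp [primitive]

theorem primitive_neg {g : ℝ → ℝ} (hodd : ∀ z, g (-z) = -g z) (z : ℝ) :
    primitive g (-z) = primitive g z := by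
  have := intervalIntegral.integral_comp_neg (a := 0) (b := z) (f := g)
  simp only [hodd, neg_zero, intervalIntegral.integral_neg] at this
  unfold primitive
  rw [intervalIntegral.integral_symm, ← this, neg_neg]

theorem primitive_abs {g : ℝ → ℝ} (hodd : ∀ z, g (-z) = -g z) (z : ℝ) :
    primitive g |z| = primitive g z := by
  rcases abs_choice z with h | h <;> rw [h]
  exact primitive_neg hodd z

/-- The quotient `g(z)/z`, extended by `g'(0)`, is continuous and positive on `[-A, A]`; `a` and `b`
are its extreme values. -/
theorem exists_linear_bounds {g : ℝ → ℝ} (hg : ContDiff ℝ 1 g) (hodd : ∀ z, g (-z) = -g z)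
    (hder : 0 < deriv g 0) {A : ℝ} (hA : 0 ≤ A) (hpos : ∀ z, 0 < z → z ≤ A → 0 < g z) :
    ∃ a b : ℝ, 0 < a ∧ a ≤ b ∧ ∀ z, |z| ≤ A → a * z ^ 2 ≤ z * g z ∧ z * g z ≤ b * z ^ 2 := by
  have hg0 : g 0 = 0 := by
    have := hodd 0
    rw [neg_zero] at this
    linarith
  have hd : Differentiable ℝ g := hg.differentiable one_ne_zero
  have hc : Continuous (dslope g 0) := by
    refine continuous_iff_continuousAt.2 fun z => ?_
    rcases eq_or_ne z 0 with rfl | hz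
    · exact continuousAt_dslope_same.2 (hd 0)
    · exact (continuousAt_dslope_of_ne hz).2 (hd z).continuousAt
  have hz : ∀ z, z * g z = dslope g 0 z * z ^ 2 := by
    intro z
    rcases eq_or_ne z 0 with rfl | hz
    · simp
    · rw [dslope_of_ne _ hz, slope_def_field, hg0]
      field_simp
      ring
  have hne : (Icc (-A) A).Nonempty := nonempty_Icc.2 (by linarith)
  obtain ⟨x, hx, hmin⟩ := isCompact_Icc.exists_isMinOn hne hc.continuousOn
  obtain ⟨y, hy, hmax⟩ := isCompact_Icc.exists_isMaxOn hne hc.continuousOn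
  refine ⟨dslope g 0 x, dslope g 0 y, ?_, hmin hy, fun z hzA => ?_⟩
  · rcases lt_trichotomy x 0 with h | rfl | h
    · have h1 := hpos (-x) (by linarith) (by linarith [hx.1])
      rw [hodd] at h1
      rw [dslope_of_ne _ h.ne, slope_def_field, hg0]
      exact div_pos_of_neg_of_neg (by linarith) (by linarith)
    · simpa using hder
    · rw [dslope_of_ne _ h.ne', slope_def_field, hg0]
      exact div_pos (by linarith [hpos x h hx.2]) (by linarith)
  · rw [hz]
    have h1 : z ∈ Icc (-A) A := abs_le.1 hzA
    exact ⟨mul_le_mul_of_nonneg_right (hmin h1) (sq_nonneg z),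
      mul_le_mul_of_nonneg_right (hmax h1) (sq_nonneg z)⟩

theorem primitive_bounds {g : ℝ → ℝ} (hg : Continuous g) (hodd : ∀ z, g (-z) = -g z)
    {a b A : ℝ} (h : ∀ z, |z| ≤ A → a * z ^ 2 ≤ z * g z ∧ z * g z ≤ b * z ^ 2) {z : ℝ}
    (hz : |z| ≤ A) : a / 2 * z ^ 2 ≤ primitive g z ∧ primitive g z ≤ b / 2 * z ^ 2 := by
  rw [← primitive_abs hodd, ← sq_abs]
  have hi : ∀ c : ℝ, c / 2 * |z| ^ 2 = ∫ s in (0 : ℝ)..|z|, c * s := by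
    intro c
    rw [intervalIntegral.integral_const_mul, integral_id]
    ring
  have hb : ∀ s ∈ Ioo (0 : ℝ) |z|, a * s ≤ g s ∧ g s ≤ b * s := by
    intro s hs
    have h1 := h s (by rw [abs_of_pos hs.1]; linarith [hs.2])
    constructor <;> nlinarith [hs.1]
  rw [hi, hi]
  constructor <;> refine intervalIntegral.integral_mono_on_of_le_Ioo (abs_nonneg z)
    (Continuous.intervalIntegrable (by fun_prop) _ _)
    (Continuous.intervalIntegrable (by fun_prop) _ _) fun s hs => ?_
  · exact (hb s hs).1
  · exact (hb s hs).2

theorem exists_lipschitz_bound {g : ℝ → ℝ} (hg : ContDiff ℝ 1 g) (A : ℝ) :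
    ∃ L : ℝ, 0 ≤ L ∧ ∀ x y, |x| ≤ A → |y| ≤ A → |g x - g y| ≤ L * |x - y| := by
  obtain ⟨L, hL⟩ := isCompact_Icc.exists_bound_of_continuousOn (s := Icc (-A) A)
    (hg.continuous_deriv le_rfl).continuousOn
  refine ⟨|L|, abs_nonneg L, fun x y hx hy => ?_⟩
  have := (convex_Icc (-A) A).norm_image_sub_le_of_norm_deriv_le (f := g) (C := |L|)
    (fun z _ => (hg.differentiable one_ne_zero) z) (fun z hz => (hL z hz).trans (le_abs_self L))
    (abs_le.1 hy) (abs_le.1 hx)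
  simpa using this

/-- The left side vanishes for linear `g`. Replacing `g(z)` by `g'(0) z` costs `O(|z|^(1+σ))`, by
Hölder continuity of `g'`, and one power more after integration or multiplication by `z`. -/
theorem exists_holder_bound {σ : ℝ≥0} {g : ℝ → ℝ} (hreg : IsC1Holder σ g)
    (hodd : ∀ z, g (-z) = -g z) (A : ℝ) :
    ∃ C : ℝ, 0 ≤ C ∧ ∀ z, |z| ≤ A →
      |2 * primitive g z - z * g z| ≤ C * (|z| ^ (σ : ℝ) * z ^ 2) := by
  obtain ⟨hg, hH⟩ := hreg
  have hg0 : g 0 = 0 := by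
    have := hodd 0
    rw [neg_zero] at this
    linarith
  obtain ⟨C, hC⟩ := hH (Icc (-A) A) isCompact_Icc
  refine ⟨3 * C, by positivity, fun z hz => ?_⟩
  set S := Icc (-|z|) |z| with hS
  have h0S : (0 : ℝ) ∈ S := by simp [hS]
  have hzS : z ∈ S := abs_le.1 le_rfl
  have hle : ∀ t ∈ S, |t| ≤ |z| := fun t ht => abs_le.2 ht
  have hA0 : 0 ≤ A := (abs_nonneg z).trans hz
  have hd1 : ∀ t ∈ S, |deriv g t - deriv g 0| ≤ C * |z| ^ (σ : ℝ) := by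
    intro t ht
    have h1 := hC.dist_le (x := t) (y := 0) (abs_le.1 ((hle t ht).trans hz)) (by simp [hA0])
    rw [Real.dist_eq, Real.dist_eq, sub_zero] at h1
    exact h1.trans (mul_le_mul_of_nonneg_left
      (Real.rpow_le_rpow (abs_nonneg t) (hle t ht) σ.coe_nonneg) C.coe_nonneg)
  have h1 : ∀ t ∈ S, |g t - deriv g 0 * t| ≤ C * |z| ^ (σ : ℝ) * |z| := by
    intro t ht
    have := (convex_Icc (-|z|) |z|).norm_image_sub_le_of_norm_hasDerivWithin_le
      (f := fun t => g t - deriv g 0 * t) (f' := fun t => deriv g t - deriv g 0)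
      (C := C * |z| ^ (σ : ℝ)) (fun t _ => ?_) hd1 h0S ht
    · simp only [hg0, mul_zero, sub_zero, Real.norm_eq_abs] at this
      exact this.trans (mul_le_mul_of_nonneg_left (hle t ht) (by positivity))
    · exact ((hg.differentiable one_ne_zero t).hasDerivAt.sub
        (((hasDerivAt_id t).const_mul (deriv g 0)).congr_deriv (mul_one _))).hasDerivWithinAt
  have h2 : |2 * primitive g z - deriv g 0 * z ^ 2| ≤ 2 * (C * |z| ^ (σ : ℝ) * |z|) * |z| := by
    have := (convex_Icc (-|z|) |z|).norm_image_sub_le_of_norm_hasDerivWithin_le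
      (f := fun t => 2 * primitive g t - deriv g 0 * t ^ 2)
      (f' := fun t => 2 * (g t - deriv g 0 * t))
      (C := 2 * (C * |z| ^ (σ : ℝ) * |z|)) (fun t _ => ?_) (fun t ht => ?_) h0S hzS
    · simpa [primitive_zero] using this
    · refine (((hasDerivAt_primitive hg.continuous t).const_mul 2).sub
        ((hasDerivAt_pow 2 t).const_mul (deriv g 0))).congr_deriv ?_ |>.hasDerivWithinAt
      simp only [Nat.cast_ofNat, Nat.add_one_sub_one, pow_one]
      ring
    · rw [norm_mul, Real.norm_eq_abs, Real.norm_eq_abs, abs_two]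
      have := h1 t ht
      gcongr
  have h3 : |z * g z - deriv g 0 * z ^ 2| ≤ C * |z| ^ (σ : ℝ) * |z| * |z| := by
    have : z * g z - deriv g 0 * z ^ 2 = (g z - deriv g 0 * z) * z := by ring
    rw [this, abs_mul]
    have := h1 z hzS
    gcongr
  calc |2 * primitive g z - z * g z|
      = |(2 * primitive g z - deriv g 0 * z ^ 2) - (z * g z - deriv g 0 * z ^ 2)| := by
        congr 1; ring
    _ ≤ 2 * (C * |z| ^ (σ : ℝ) * |z|) * |z| + C * |z| ^ (σ : ℝ) * |z| * |z| :=
        (abs_sub _ _).trans (add_le_add h2 h3)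
    _ = _ := by rw [← sq_abs z]; ring

/-! ### Energy monotonicity and the a priori bound -/

namespace IsRadialProfile

variable {n : ℕ} {g : ℝ → ℝ} {α : ℝ} {u : ℝ → ℝ}

/-- The dissipation `(n/r) u'²`, written through the mean, has no singularity at `0`, so the energy
can be compared with its value at the origin. -/
theorem hasDerivAt_energy (hu : IsRadialProfile n g α u) (hg : Continuous g) (r : ℝ) :
    HasDerivAt (fun r => deriv u r ^ 2 / 2 + primitive g (u r))
      (-(n * r * radialMean n (g ∘ u) r ^ 2)) r := by
  rw [hu.deriv_eq]
  refine ((((hu.hasDerivAt_deriv hg r).pow 2).div_const 2).add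
    ((hasDerivAt_primitive hg (u r)).comp r (hu.hasDerivAt r))).congr_deriv ?_
  simp only [Nat.cast_ofNat, Nat.add_one_sub_one, pow_one]
  ring

theorem antitoneOn_energy (hu : IsRadialProfile n g α u) (hg : Continuous g) :
    AntitoneOn (fun r => deriv u r ^ 2 / 2 + primitive g (u r)) (Ici 0) := by
  refine antitoneOn_of_hasDerivWithinAt_nonpos (convex_Ici 0)
    (fun r _ => (hu.hasDerivAt_energy hg r).continuousAt.continuousWithinAt)
    (fun r _ => (hu.hasDerivAt_energy hg r).hasDerivWithinAt) fun r hr => ?_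
  rw [interior_Ici] at hr
  have : 0 < r := hr
  simp only [Left.neg_nonpos_iff]
  positivity

theorem energy_le (hu : IsRadialProfile n g α u) (hg : Continuous g) {r : ℝ} (hr : 0 ≤ r) :
    deriv u r ^ 2 / 2 + primitive g (u r) ≤ primitive g α := by
  have := hu.antitoneOn_energy hg self_mem_Ici (mem_Ici.2 hr) hr
  simpa [hu.deriv_eq, hu.zero] using this

end IsRadialProfile

/-- The truncation of `g` is bounded, Lipschitz, odd and positive on all of `(0, ∞)`. Its primitive
is thus strictly increasing on `[0, ∞)`, and energy decay confines the solution to the range where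
nothing was truncated. -/
theorem exists_isRadialProfile_of_pos (n : ℕ) {g : ℝ → ℝ} (hg : ContDiff ℝ 1 g)
    (hodd : ∀ z, g (-z) = -g z) (α : ℝ) (hpos : ∀ z, 0 < z → z ≤ |α| → 0 < g z) :
    ∃ u, IsRadialProfile n g α u ∧ ∀ r, |u r| ≤ |α| := by
  rcases eq_or_ne α 0 with rfl | hα
  · have hg0 : g 0 = 0 := by
      have := hodd 0
      rw [neg_zero] at this
      linarith
    refine ⟨fun _ => 0, ⟨rfl, fun r => ?_, fun _ => rfl⟩, fun r => by simp⟩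
    simpa [radialMean, hg0] using hasDerivAt_const r (0 : ℝ)
  set A := |α| with hA
  have hA0 : 0 < A := abs_pos.2 hα
  let clamp : ℝ → ℝ := fun z => max (-A) (min A z)
  have hcA : ∀ z, |clamp z| ≤ A := fun z =>
    abs_le.2 ⟨le_max_left _ _, max_le (by linarith) (min_le_left _ _)⟩
  have hcid : ∀ z, |z| ≤ A → clamp z = z := fun z hz => by
    simp only [clamp]
    rw [min_eq_right (abs_le.1 hz).2, max_eq_right (abs_le.1 hz).1]
  have hcodd : ∀ z, clamp (-z) = -clamp z := fun z => by
    simp only [clamp]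
    grind
  have hclip : ∀ x y, |clamp x - clamp y| ≤ |x - y| := fun x y =>
    (abs_max_sub_max_le_max _ _ _ _).trans (by
      simp only [sub_self, abs_zero]
      refine max_le (abs_nonneg _) ((abs_min_sub_min_le_max _ _ _ _).trans ?_)
      simp)
  have hccont : Continuous clamp := by fun_prop
  obtain ⟨L, hL, hLip⟩ := exists_lipschitz_bound hg A
  obtain ⟨B, hB⟩ := isCompact_Icc.exists_bound_of_continuousOn (s := Icc (-A) A)
    hg.continuous.continuousOn
  set f : ℝ → ℝ := fun z => g (clamp z) with hf
  have hfc : Continuous f := hg.continuous.comp hccont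
  have hfodd : ∀ z, f (-z) = -f z := fun z => by simp only [hf, hcodd, hodd]
  have hfpos : ∀ z, 0 < z → 0 < f z := fun z hz => by
    refine hpos _ (lt_max_of_lt_right (lt_min hA0 hz)) ((le_abs_self _).trans (hcA z))
  obtain ⟨u, hu⟩ := exists_isRadialProfile n (g := f) hL
    (fun x y => (hLip _ _ (hcA x) (hcA y)).trans (mul_le_mul_of_nonneg_left (hclip x y) hL))
    (fun x => hB _ (abs_le.1 (hcA x))) α
  have hmono : StrictMonoOn (primitive f) (Ici 0) := by
    refine strictMonoOn_of_deriv_pos (convex_Ici 0)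
      (fun r _ => (hasDerivAt_primitive hfc r).continuousAt.continuousWithinAt) fun r hr => ?_
    rw [interior_Ici] at hr
    rw [(hasDerivAt_primitive hfc r).deriv]
    exact hfpos r hr
  have hub0 : ∀ r, 0 ≤ r → |u r| ≤ A := by
    intro r hr
    have h1 := hu.energy_le hfc hr
    rw [← primitive_abs hfodd (u r), ← primitive_abs hfodd α] at h1
    refine (hmono.le_iff_le (abs_nonneg (u r)) (abs_nonneg α)).1 ?_
    nlinarith [sq_nonneg (deriv u r)]
  have hub : ∀ r, |u r| ≤ A := by
    intro r
    rcases le_total 0 r with h | h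
    · exact hub0 r h
    · rw [← hu.even]
      exact hub0 _ (by linarith)
  have hfg : f ∘ u = g ∘ u := funext fun r => by simp only [hf, Function.comp, hcid _ (hub r)]
  exact ⟨u, ⟨hu.zero, fun r => hfg ▸ hu.hasDerivAt r, hu.even⟩, hub⟩

/-! ### Damped oscillations: zeros and decay of the energy -/

theorem mul_exp_le_of_deriv_le {f f' κ k : ℝ → ℝ} {R : ℝ}
    (hf : ∀ r, R ≤ r → HasDerivAt f (f' r) r) (hκ : ∀ r, R ≤ r → HasDerivAt κ (k r) r)
    (h : ∀ r, R ≤ r → f' r ≤ k r * f r) {r : ℝ} (hr : R ≤ r) :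
    f r * Real.exp (-κ r) ≤ f R * Real.exp (-κ R) := by
  have hd : ∀ r, R ≤ r → HasDerivAt (fun r => f r * Real.exp (-κ r))
      ((f' r - k r * f r) * Real.exp (-κ r)) r := fun r hr =>
    ((hf r hr).mul (hκ r hr).neg.exp).congr_deriv (by simp only [Pi.neg_apply]; ring)
  refine antitoneOn_of_hasDerivWithinAt_nonpos (convex_Ici R)
    (fun r hr => (hd r hr).continuousAt.continuousWithinAt)
    (fun r hr => (hd r (interior_subset hr)).hasDerivWithinAt)
    (fun r hr => ?_) self_mem_Ici (mem_Ici.2 hr) hr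
  have := h r (interior_subset hr)
  exact mul_nonpos_of_nonpos_of_nonneg (by linarith) (Real.exp_pos _).le

theorem le_mul_exp_of_le_deriv {f f' κ k : ℝ → ℝ} {R : ℝ}
    (hf : ∀ r, R ≤ r → HasDerivAt f (f' r) r) (hκ : ∀ r, R ≤ r → HasDerivAt κ (k r) r)
    (h : ∀ r, R ≤ r → k r * f r ≤ f' r) {r : ℝ} (hr : R ≤ r) :
    f R * Real.exp (-κ R) ≤ f r * Real.exp (-κ r) := by
  have := mul_exp_le_of_deriv_le (f := -f) (f' := -f') (fun r hr => (hf r hr).neg) hκ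
    (fun r hr => by simp only [Pi.neg_apply]; linarith [h r hr]) hr
  simp only [Pi.neg_apply] at this
  linarith

/-- A solution of `u'' + (n/r) u' + g(u) = 0` on `(0, ∞)`, with `p = u'` and `G' = g`, along which
the nonlinearity is comparable to a linear one. -/
structure IsDampedOscillation (n : ℕ) (g G u p : ℝ → ℝ) (a b : ℝ) : Prop where
  pos : 0 < a
  le : a ≤ b
  hasDerivAt_left : ∀ r, 0 < r → HasDerivAt u (p r) r
  hasDerivAt_right : ∀ r, 0 < r → HasDerivAt p (-(n / r) * p r - g (u r)) r
  hasDerivAt_primitive : ∀ z, HasDerivAt G (g z) z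
  bounds : ∀ r, 0 < r → a * u r ^ 2 ≤ u r * g (u r) ∧ u r * g (u r) ≤ b * u r ^ 2
  primitive_bounds : ∀ r, 0 < r → a / 2 * u r ^ 2 ≤ G (u r) ∧ G (u r) ≤ b / 2 * u r ^ 2

namespace IsDampedOscillation

variable {n : ℕ} {g G u p : ℝ → ℝ} {a b : ℝ}

/-- If `u` had no zero beyond `R`, the phase `arctan(-u'/u)` would be defined there and eventually
grow at least at rate `c > 0`, although it is bounded. -/
theorem exists_zero (h : IsDampedOscillation n g G u p a b) (R : ℝ) : ∃ r, R < r ∧ u r = 0 := by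
  by_contra! hne
  have ha := h.pos
  -- Beyond `n / √a` one has `(n/r)² ≤ a`, and completing the square shows that damping cannot
  -- cancel more than half of the rotation.
  obtain ⟨R₁, hR₁, hR₁0, hR₁n⟩ : ∃ R₁ : ℝ, R < R₁ ∧ 0 < R₁ ∧ n / Real.sqrt a ≤ R₁ :=
    ⟨max R (max 0 (n / Real.sqrt a)) + 1, lt_of_le_of_lt (le_max_left _ _) (by linarith),
      lt_of_le_of_lt ((le_max_left _ _).trans (le_max_right _ _)) (lt_add_one _),
      ((le_max_right _ _).trans (le_max_right _ _)).trans (lt_add_one _).le⟩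
  set c : ℝ := min 1 a / 2 with hc
  have hc0 : 0 < c := by positivity
  have hd : ∀ r, R₁ ≤ r → HasDerivAt (fun r => -(p r / u r))
      ((p r / u r) ^ 2 + n / r * (p r / u r) + u r * g (u r) / u r ^ 2) r := by
    intro r hr
    have hr0 : 0 < r := by linarith
    have hu0 := hne r (by linarith)
    refine (((h.hasDerivAt_right r hr0).div (h.hasDerivAt_left r hr0) hu0).neg).congr_deriv ?_
    field_simp
    ring
  have hd2 : ∀ r, R₁ ≤ r → HasDerivAt (fun r => Real.arctan (-(p r / u r)) - c * r)
      (1 / (1 + (-(p r / u r)) ^ 2) *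
        ((p r / u r) ^ 2 + n / r * (p r / u r) + u r * g (u r) / u r ^ 2) - c) r := fun r hr =>
    (hd r hr).arctan.sub (((hasDerivAt_id r).const_mul c).congr_deriv (mul_one c))
  have hmono : MonotoneOn (fun r => Real.arctan (-(p r / u r)) - c * r) (Ici R₁) := by
    refine monotoneOn_of_hasDerivWithinAt_nonneg (convex_Ici _)
      (fun r hr => (hd2 r hr).continuousAt.continuousWithinAt)
      (fun r hr => (hd2 r (interior_subset hr)).hasDerivWithinAt) fun r hr => ?_
    have hr : R₁ ≤ r := interior_subset hr
    have hr0 : 0 < r := by linarith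
    have hu0 := hne r (by linarith)
    have h1 : a ≤ u r * g (u r) / u r ^ 2 := by
      rw [le_div_iff₀ (by positivity)]
      exact (h.bounds r hr0).1
    have h2 : (n / r) ^ 2 ≤ a := by
      have : (n : ℝ) / r ≤ Real.sqrt a := by
        rw [div_le_iff₀ hr0, mul_comm, ← div_le_iff₀ (Real.sqrt_pos.2 ha)]
        linarith
      calc ((n : ℝ) / r) ^ 2 ≤ Real.sqrt a ^ 2 := by gcongr
        _ = a := Real.sq_sqrt ha.le
    set v := p r / u r
    have h3 : min 1 a * (1 + v ^ 2) ≤ a + v ^ 2 := by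
      rw [mul_add, mul_one]
      exact add_le_add (min_le_right 1 a) (mul_le_of_le_one_left (sq_nonneg v) (min_le_left 1 a))
    rw [sub_nonneg, neg_sq, one_div, inv_mul_eq_div, le_div_iff₀ (by positivity), hc]
    generalize u r * g (u r) / u r ^ 2 = q at h1 ⊢
    generalize (n : ℝ) / r = k at h2 ⊢
    linarith [sq_nonneg (k + v), add_sq k v]
  -- Over length `(π + 1) / c` the phase gains `π + 1`, more than the width `π` of the range of
  -- `arctan`.
  have h1 := hmono self_mem_Ici (b := R₁ + (Real.pi + 1) / c)
    (mem_Ici.2 (by have := Real.pi_pos; have : 0 < (Real.pi + 1) / c := by positivity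
                   linarith))
    (by have := Real.pi_pos; have : 0 < (Real.pi + 1) / c := by positivity
        linarith)
  have h2 : c * ((Real.pi + 1) / c) = Real.pi + 1 := by field_simp
  simp only [mul_add, h2] at h1
  have h3 := Real.arctan_lt_pi_div_two
    (-(p (R₁ + (Real.pi + 1) / c) / u (R₁ + (Real.pi + 1) / c)))
  have h4 := Real.neg_pi_div_two_lt_arctan (-(p R₁ / u R₁))
  linarith

theorem energy_bounds (h : IsDampedOscillation n g G u p a b) {r : ℝ} (hr : 0 < r) :
    u r ^ 2 ≤ 2 / a * (p r ^ 2 / 2 + G (u r)) ∧ p r ^ 2 ≤ 2 * (p r ^ 2 / 2 + G (u r)) ∧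
      |u r * p r| ≤ (1 + 1 / a) * (p r ^ 2 / 2 + G (u r)) ∧
      p r ^ 2 / 2 + G (u r) ≤ (1 + b) / 2 * (u r ^ 2 + p r ^ 2) := by
  have ha := h.pos
  have hb := h.le
  obtain ⟨h1, h2⟩ := h.primitive_bounds r hr
  have h3 : u r ^ 2 ≤ 2 / a * (p r ^ 2 / 2 + G (u r)) := by
    rw [div_mul_eq_mul_div, le_div_iff₀ ha]
    nlinarith [sq_nonneg (p r)]
  have h4 : p r ^ 2 ≤ 2 * (p r ^ 2 / 2 + G (u r)) := by nlinarith [sq_nonneg (u r)]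
  refine ⟨h3, h4, ?_, by nlinarith [sq_nonneg (u r), sq_nonneg (p r)]⟩
  have h5 : 2 * |u r * p r| ≤ u r ^ 2 + p r ^ 2 := by
    rw [abs_mul, ← sq_abs (u r), ← sq_abs (p r)]
    nlinarith [sq_nonneg (|u r| - |p r|)]
  have h6 : 2 / a * (p r ^ 2 / 2 + G (u r)) = 2 * (1 / a * (p r ^ 2 / 2 + G (u r))) := by ring
  linarith

theorem energy_nonneg (h : IsDampedOscillation n g G u p a b) {r : ℝ} (hr : 0 < r) :
    0 ≤ p r ^ 2 / 2 + G (u r) := by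
  linarith [(h.energy_bounds hr).2.1, sq_nonneg (p r)]

theorem hasDerivAt_energy (h : IsDampedOscillation n g G u p a b) {r : ℝ} (hr : 0 < r) :
    HasDerivAt (fun r => p r ^ 2 / 2 + G (u r)) (-(n / r) * p r ^ 2) r := by
  refine ((((h.hasDerivAt_right r hr).pow 2).div_const 2).add
    ((h.hasDerivAt_primitive (u r)).comp r (h.hasDerivAt_left r hr))).congr_deriv ?_
  simp only [Nat.cast_ofNat, Nat.add_one_sub_one, pow_one]
  ring

/-- Multiplied by `r²ⁿ`, the energy is nondecreasing. -/
theorem pow_mul_energy_le (h : IsDampedOscillation n g G u p a b) {r s : ℝ} (hr : 0 < r)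
    (hrs : r ≤ s) :
    r ^ (2 * n) * (p r ^ 2 / 2 + G (u r)) ≤ s ^ (2 * n) * (p s ^ 2 / 2 + G (u s)) := by
  have h1 := le_mul_exp_of_le_deriv (R := r) (κ := fun x => -(2 * n * Real.log x))
    (k := fun x => -(2 * n * x⁻¹))
    (fun x hx => h.hasDerivAt_energy (hr.trans_le hx))
    (fun x hx => ((Real.hasDerivAt_log (hr.trans_le hx).ne').const_mul (2 * n : ℝ)).neg)
    (fun x hx => by
      have hx0 : 0 < x := hr.trans_le hx
      have h2 := (h.energy_bounds hx0).2.1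
      have : 0 ≤ n / x := by positivity
      have h3 : 2 * n * x⁻¹ = 2 * (n / x) := by ring
      rw [h3]
      nlinarith [mul_le_mul_of_nonneg_left h2 this]) hrs
  have h2 : ∀ x, 0 < x → Real.exp (- -(2 * n * Real.log x)) = x ^ (2 * n) := fun x hx => by
    rw [neg_neg, ← Real.rpow_natCast, Real.rpow_def_of_pos hx, mul_comm (Real.log x)]
    push_cast
    rfl
  rw [h2 r hr, h2 s (hr.trans_le hrs)] at h1
  linarith

/-- The cross term trades part of the loss in `u'²` for a loss in `u g(u)`. With `m = n/2` both have
weight `n/(2r)`, and the remainder is one order smaller in `1/r`. -/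
theorem hasDerivAt_corrected (h : IsDampedOscillation n g G u p a b) (m : ℝ) {r : ℝ}
    (hr : 0 < r) :
    HasDerivAt (fun r => p r ^ 2 / 2 + G (u r) + m / r * (u r * p r))
      (-((n - m) / r * p r ^ 2) - m / r * (u r * g (u r)) - m * (n + 1) / r ^ 2 * (u r * p r))
      r := by
  refine ((h.hasDerivAt_energy hr).add (((hasDerivAt_const r m).div (hasDerivAt_id r) hr.ne').mul
    ((h.hasDerivAt_left r hr).mul (h.hasDerivAt_right r hr)))).congr_deriv ?_
  simp only [id, Pi.div_apply, Pi.mul_apply]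
  field_simp
  ring

theorem abs_corrected_sub_le (h : IsDampedOscillation n g G u p a b) {r : ℝ} (hr : 0 < r)
    (hr' : n * (1 + 1 / a) ≤ r) :
    |n / 2 / r * (u r * p r)| ≤ 1 / 2 * (p r ^ 2 / 2 + G (u r)) := by
  have h1 := (h.energy_bounds hr).2.2.1
  have h0 := h.energy_nonneg hr
  have : 0 ≤ n / 2 / r := by positivity
  rw [abs_mul, abs_of_nonneg this]
  calc _ ≤ n / 2 / r * ((1 + 1 / a) * (p r ^ 2 / 2 + G (u r))) := by gcongr
    _ = n * (1 + 1 / a) / r * (1 / 2 * (p r ^ 2 / 2 + G (u r))) := by ring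
    _ ≤ 1 * (1 / 2 * (p r ^ 2 / 2 + G (u r))) := by
        gcongr
        rwa [div_le_one hr]
    _ = _ := one_mul _

/-- Here `u g(u)` controls `G(u)` only up to the ratio `a / b`, so the rate is not sharp; any
positive rate suffices to make the Hölder defect integrable later. -/
theorem exists_energy_le_rpow (h : IsDampedOscillation n g G u p a b) (hn : 1 ≤ n) :
    ∃ δ K R : ℝ, 0 < δ ∧ 0 ≤ K ∧ 1 ≤ R ∧
      ∀ r, R ≤ r → p r ^ 2 / 2 + G (u r) ≤ K * r ^ (-δ) := by
  have ha := h.pos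
  have hb : 0 < b := ha.trans_le h.le
  have hn' : (1 : ℝ) ≤ n := by exact_mod_cast hn
  -- The loss is at least `(n/(2r)) (a/b) E` once half of it has paid for the cross term, and the
  -- corrected energy is at most `(3/2) E`.
  set δ : ℝ := n * (a / b) / 3 with hδ
  have hδ0 : 0 < δ := by positivity
  set R : ℝ := max 1 (max (n * (1 + 1 / a)) ((n + 1) * (1 + 1 / a) / (a / b))) with hR
  have hR1 : 1 ≤ R := le_max_left _ _
  have hR2 : n * (1 + 1 / a) ≤ R := (le_max_left _ _).trans (le_max_right _ _)
  have hR3 : (n + 1) * (1 + 1 / a) / (a / b) ≤ R := (le_max_right _ _).trans (le_max_right _ _)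
  have hd := fun (r : ℝ) (hr : R ≤ r) =>
    h.hasDerivAt_corrected (n / 2 : ℝ) (r := r) (by linarith)
  have hL : ∀ r, R ≤ r →
      1 / 2 * (p r ^ 2 / 2 + G (u r)) ≤ p r ^ 2 / 2 + G (u r) + n / 2 / r * (u r * p r) ∧
      p r ^ 2 / 2 + G (u r) + n / 2 / r * (u r * p r) ≤ 3 / 2 * (p r ^ 2 / 2 + G (u r)) := by
    intro r hr
    have := abs_le.1 (h.abs_corrected_sub_le (r := r) (by linarith) (by linarith))
    constructor <;> linarith
  have hderiv : ∀ r, R ≤ r → -((n - n / 2 : ℝ) / r * p r ^ 2) - n / 2 / r * (u r * g (u r)) -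
      n / 2 * (n + 1) / r ^ 2 * (u r * p r) ≤
        -(δ * r⁻¹) * (p r ^ 2 / 2 + G (u r) + n / 2 / r * (u r * p r)) := by
    intro r hr
    have hr0 : 0 < r := by linarith
    obtain ⟨h1, h2⟩ := hL r hr
    obtain ⟨h3, h4, h5, -⟩ := h.energy_bounds hr0
    have h0 := h.energy_nonneg hr0
    have h6 := (h.bounds r hr0).1
    have h7 := (h.primitive_bounds r hr0).2
    set e := p r ^ 2 / 2 + G (u r) with he
    have hab : a / b ≤ 1 := (div_le_one hb).2 h.le
    have hG : 0 ≤ G (u r) := by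
      have := (h.primitive_bounds r hr0).1
      have : 0 ≤ a / 2 * u r ^ 2 := by positivity
      linarith
    have h8 : 2 * (a / b) * e ≤ p r ^ 2 + u r * g (u r) := by
      have h81 : a / b * G (u r) ≤ a / 2 * u r ^ 2 := by
        rw [div_mul_eq_mul_div, div_le_iff₀ hb]
        nlinarith
      have h82 : a / b * p r ^ 2 ≤ p r ^ 2 := mul_le_of_le_one_left (sq_nonneg _) hab
      rw [he]
      linarith
    have h9 : (n + 1) / r * |u r * p r| ≤ a / b * e := by
      calc _ ≤ (n + 1) / r * ((1 + 1 / a) * e) := by gcongr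
        _ = ((n + 1) * (1 + 1 / a)) / r * e := by ring
        _ ≤ _ := by
          refine mul_le_mul_of_nonneg_right ?_ h0
          rw [div_le_iff₀ hr0, mul_comm (a / b), ← div_le_iff₀ (by positivity)]
          linarith
    have h10 : -((n + 1) / r * (u r * p r)) ≤ (n + 1) / r * |u r * p r| := by
      rw [← mul_neg]
      gcongr
      exact neg_le_abs _
    have e1 : -((n - n / 2 : ℝ) / r * p r ^ 2) - n / 2 / r * (u r * g (u r)) -
        n / 2 * (n + 1) / r ^ 2 * (u r * p r) = n / 2 / r * (-(p r ^ 2 + u r * g (u r)) +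
          -((n + 1) / r * (u r * p r))) := by
      field_simp
      ring
    have e2 : δ * r⁻¹ = n / 2 / r * (2 / 3 * (a / b)) := by
      rw [hδ]
      ring
    have h11 : 2 / 3 * (a / b) * (e + n / 2 / r * (u r * p r)) ≤
        2 / 3 * (a / b) * (3 / 2 * e) := by
      gcongr
    rw [e1, e2]
    calc _ ≤ n / 2 / r * -(2 / 3 * (a / b) * (e + n / 2 / r * (u r * p r))) := by
          refine mul_le_mul_of_nonneg_left ?_ (by positivity)
          linarith
      _ = _ := by ring
  have key := fun (r : ℝ) (hr : R ≤ r) => mul_exp_le_of_deriv_le (R := R)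
    (κ := fun x => -(δ * Real.log x))
    (k := fun x => -(δ * x⁻¹)) hd
    (fun x hx => ((Real.hasDerivAt_log (by linarith : (0 : ℝ) < x).ne').const_mul δ).neg)
    hderiv hr
  set K0 := (p R ^ 2 / 2 + G (u R) + n / 2 / R * (u R * p R)) *
    Real.exp (- -(δ * Real.log R)) with hK0
  have hK00 : 0 ≤ K0 := by
    have := (hL R le_rfl).1
    have := h.energy_nonneg (r := R) (by linarith)
    exact mul_nonneg (by linarith) (Real.exp_pos _).le
  refine ⟨δ, 2 * K0, R, hδ0, by positivity, hR1, fun r hr => ?_⟩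
  have hr0 : 0 < r := by linarith
  have h1 := key r hr
  have h2 : Real.exp (- -(δ * Real.log r)) = r ^ δ := by
    rw [neg_neg, Real.rpow_def_of_pos hr0, mul_comm]
  rw [h2] at h1
  have h3 := (hL r hr).1
  have h4 : 0 < r ^ δ := Real.rpow_pos_of_pos hr0 δ
  rw [Real.rpow_neg hr0.le, ← div_eq_mul_inv, le_div_iff₀ h4]
  nlinarith

theorem tendsto_energy (h : IsDampedOscillation n g G u p a b) (hn : 1 ≤ n) :
    Tendsto (fun r => p r ^ 2 / 2 + G (u r)) atTop (𝓝 0) := by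
  obtain ⟨δ, K, R, hδ, -, hR, hle⟩ := h.exists_energy_le_rpow hn
  have h1 : Tendsto (fun r : ℝ => K * r ^ (-δ)) atTop (𝓝 0) := by
    simpa using (tendsto_rpow_neg_atTop hδ).const_mul K
  refine tendsto_of_tendsto_of_tendsto_of_le_of_le' tendsto_const_nhds h1 ?_ ?_
  · filter_upwards [eventually_gt_atTop 0] with r hr using h.energy_nonneg hr
  · filter_upwards [eventually_ge_atTop R] with r hr using hle r hr

/-- In the derivative of `rⁿ` times the corrected energy the leading terms cancel, leaving the
defect `2G(u) - u g(u)` and a cross term. Both are integrable relative to the quantity itself, which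
bounds it from above and away from zero. -/
theorem exists_pow_mul_energy_bounds (h : IsDampedOscillation n g G u p a b) (hn : 1 ≤ n)
    {σ C : ℝ} (hσ : 0 < σ) (hC : 0 ≤ C)
    (hH : ∀ r, 0 < r → |2 * G (u r) - u r * g (u r)| ≤ C * (|u r| ^ σ * u r ^ 2))
    (hne : ∀ r, 0 < r → 0 < p r ^ 2 / 2 + G (u r)) :
    ∃ c K R : ℝ, 0 < c ∧ 0 < K ∧ 1 ≤ R ∧ ∀ r, R ≤ r →
      c ≤ r ^ n * (p r ^ 2 / 2 + G (u r)) ∧ r ^ n * (p r ^ 2 / 2 + G (u r)) ≤ K := by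
  have ha := h.pos
  obtain ⟨δ, K, R₀, hδ, hK, hR₀, hdecay⟩ := h.exists_energy_le_rpow hn
  -- The preliminary decay gives `|u|^σ = O(r^(-δσ/2))`; the cap `1` accounts for the cross term,
  -- smaller by `1/r`.
  set ε : ℝ := min 1 (δ * σ / 2) with hε
  have hε0 : 0 < ε := by positivity
  set R : ℝ := max R₀ (n * (1 + 1 / a)) with hR
  have hRR₀ : R₀ ≤ R := le_max_left _ _
  have hR2 : n * (1 + 1 / a) ≤ R := le_max_right _ _
  set D : ℝ := C * (2 / a * K) ^ (σ / 2) * (2 / a) with hD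
  have hD0 : 0 ≤ D := by positivity
  set M : ℝ := n * (D + (1 + 1 / a)) with hM
  have hM0 : 0 ≤ M := by positivity
  have hd : ∀ r, R ≤ r → HasDerivAt
      (fun r => r ^ n * (p r ^ 2 / 2 + G (u r) + n / 2 / r * (u r * p r)))
      (r ^ n * (n / 2 / r * (2 * G (u r) - u r * g (u r)) - n / 2 / r ^ 2 * (u r * p r))) r := by
    intro r hr
    have hr0 : 0 < r := by linarith
    refine ((hasDerivAt_pow n r).mul (h.hasDerivAt_corrected (n / 2 : ℝ) hr0)).congr_deriv ?_
    have hpow : r ^ n = r ^ (n - 1) * r := by rw [← pow_succ, Nat.sub_add_cancel hn]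
    rw [hpow]
    field_simp
    ring
  have hL : ∀ r, R ≤ r →
      1 / 2 * (p r ^ 2 / 2 + G (u r)) ≤ p r ^ 2 / 2 + G (u r) + n / 2 / r * (u r * p r) ∧
      p r ^ 2 / 2 + G (u r) + n / 2 / r * (u r * p r) ≤ 3 / 2 * (p r ^ 2 / 2 + G (u r)) := by
    intro r hr
    have := abs_le.1 (h.abs_corrected_sub_le (r := r) (by linarith) (by linarith))
    constructor <;> linarith
  have hderiv : ∀ r, R ≤ r →
      |r ^ n * (n / 2 / r * (2 * G (u r) - u r * g (u r)) - n / 2 / r ^ 2 * (u r * p r))| ≤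
        M * r ^ (-ε - 1) * (r ^ n * (p r ^ 2 / 2 + G (u r) + n / 2 / r * (u r * p r))) := by
    intro r hr
    have hr0 : 0 < r := by linarith
    have hr1 : 1 ≤ r := by linarith
    obtain ⟨h3, -, h5, -⟩ := h.energy_bounds hr0
    have hL1 := (hL r hr).1
    have h0 := h.energy_nonneg hr0
    have hdec := hdecay r (by linarith)
    have hHr := hH r hr0
    set e := p r ^ 2 / 2 + G (u r) with he
    have h6 : |u r| ^ σ ≤ (2 / a * K) ^ (σ / 2) * r ^ (-ε) := by
      have h61 : |u r| ^ σ = (u r ^ 2) ^ (σ / 2) := by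
        rw [← sq_abs, ← Real.rpow_natCast, ← Real.rpow_mul (abs_nonneg _)]
        congr 1
        push_cast
        ring
      have h62 : u r ^ 2 ≤ 2 / a * K * r ^ (-δ) := h3.trans (by rw [mul_assoc]; gcongr)
      calc |u r| ^ σ ≤ (2 / a * K * r ^ (-δ)) ^ (σ / 2) := by
            rw [h61]
            exact Real.rpow_le_rpow (sq_nonneg _) h62 (by positivity)
        _ = (2 / a * K) ^ (σ / 2) * r ^ (-δ * (σ / 2)) := by
            rw [Real.mul_rpow (by positivity) (by positivity), ← Real.rpow_mul hr0.le]
        _ ≤ _ := by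
            refine mul_le_mul_of_nonneg_left (Real.rpow_le_rpow_of_exponent_le hr1 ?_)
              (by positivity)
            have : ε ≤ δ * σ / 2 := min_le_right _ _
            linarith
    have h7 : |2 * G (u r) - u r * g (u r)| ≤ D * r ^ (-ε) * e := by
      calc _ ≤ C * (|u r| ^ σ * u r ^ 2) := hHr
        _ ≤ C * ((2 / a * K) ^ (σ / 2) * r ^ (-ε) * (2 / a * e)) := by gcongr
        _ = _ := by rw [hD]; ring
    have h8 : 1 / r ≤ r ^ (-ε) := by
      rw [one_div, ← Real.rpow_neg_one]
      exact Real.rpow_le_rpow_of_exponent_le hr1 (neg_le_neg (min_le_left _ _))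
    have h9 : |n / 2 / r * (2 * G (u r) - u r * g (u r)) - n / 2 / r ^ 2 * (u r * p r)| ≤
        n / 2 / r * ((D + (1 + 1 / a)) * r ^ (-ε) * e) := by
      have e1 : n / 2 / r * (2 * G (u r) - u r * g (u r)) - n / 2 / r ^ 2 * (u r * p r) =
          n / 2 / r * ((2 * G (u r) - u r * g (u r)) - 1 / r * (u r * p r)) := by
        field_simp
      have hn0 : 0 ≤ n / 2 / r := by positivity
      rw [e1, abs_mul, abs_of_nonneg hn0]
      refine mul_le_mul_of_nonneg_left ?_ hn0
      refine (abs_sub _ _).trans ?_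
      rw [abs_mul (1 / r), abs_of_nonneg (by positivity : 0 ≤ 1 / r)]
      calc _ ≤ D * r ^ (-ε) * e + r ^ (-ε) * ((1 + 1 / a) * e) := by gcongr
        _ = _ := by ring
    have h10 : r ^ (-ε - 1) = r ^ (-ε) / r := by rw [Real.rpow_sub_one hr0.ne']
    rw [abs_mul, abs_of_nonneg (by positivity : 0 ≤ r ^ n), h10]
    calc _ ≤ r ^ n * (n / 2 / r * ((D + (1 + 1 / a)) * r ^ (-ε) * e)) := by gcongr
      _ = M * (r ^ (-ε) / r) * (r ^ n * (1 / 2 * e)) := by rw [hM]; ring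
      _ ≤ _ := by gcongr
  -- The primitive of the integrable rate `M r^(-ε-1)` is bounded on `[R, ∞)`, so both integrating
  -- factors stay between positive constants.
  have hκ : ∀ r, R ≤ r → HasDerivAt (fun r => -(M / ε * r ^ (-ε))) (M * r ^ (-ε - 1)) r := by
    intro r hr
    refine (((Real.hasDerivAt_rpow_const (p := -ε)
      (Or.inl (by linarith : (0 : ℝ) < r).ne')).const_mul (M / ε)).neg).congr_deriv ?_
    field_simp
  have hκ' : ∀ r, R ≤ r → HasDerivAt (fun r => M / ε * r ^ (-ε)) (-(M * r ^ (-ε - 1))) r :=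
    fun r hr => by simpa [Function.comp_def, Pi.neg_def] using (hκ r hr).neg
  have hup := fun (r : ℝ) (hr : R ≤ r) => mul_exp_le_of_deriv_le hd hκ
    (fun r hr => (le_abs_self _).trans (hderiv r hr)) hr
  have hlow := fun (r : ℝ) (hr : R ≤ r) => le_mul_exp_of_le_deriv hd hκ'
    (fun r hr => by
      rw [neg_mul]
      exact (abs_le.1 (hderiv r hr)).1) hr
  set J := R ^ n * (p R ^ 2 / 2 + G (u R) + n / 2 / R * (u R * p R)) with hJ
  have hR0 : 0 < R := by linarith
  have hJ0 : 0 < J := mul_pos (pow_pos hR0 n)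
    (lt_of_lt_of_le (by linarith [hne R hR0]) (hL R le_rfl).1)
  refine ⟨J * Real.exp (-(M / ε * R ^ (-ε))) * (2 / 3),
    J * Real.exp (- -(M / ε * R ^ (-ε))) * 2, R, by positivity, by positivity, by linarith,
    fun r hr => ?_⟩
  have hr0 : 0 < r := by linarith
  have h1 := hup r hr
  have h2 := hlow r hr
  obtain ⟨h3, h4⟩ := hL r hr
  have h5 : 0 < r ^ n := by positivity
  have h6 : 0 < p r ^ 2 / 2 + G (u r) := hne r hr0
  have h7 : 0 ≤ M / ε * r ^ (-ε) := by positivity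
  have h8 : 1 ≤ Real.exp (- -(M / ε * r ^ (-ε))) := Real.one_le_exp (by linarith)
  have h9 : Real.exp (-(M / ε * r ^ (-ε))) ≤ 1 := Real.exp_le_one_iff.2 (by linarith)
  set ℓ := r ^ n * (p r ^ 2 / 2 + G (u r) + n / 2 / r * (u r * p r)) with hℓ
  have h10 : r ^ n * (1 / 2 * (p r ^ 2 / 2 + G (u r))) ≤ ℓ :=
    mul_le_mul_of_nonneg_left h3 h5.le
  have h11 : ℓ ≤ r ^ n * (3 / 2 * (p r ^ 2 / 2 + G (u r))) :=
    mul_le_mul_of_nonneg_left h4 h5.le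
  have h12 : 0 ≤ ℓ := le_trans (by positivity) h10
  have h13 := mul_le_mul_of_nonneg_left h8 h12
  have h14 := mul_le_mul_of_nonneg_left h9 h12
  constructor <;> linarith

end IsDampedOscillation

/-! ### Radial functions on an inner product space: derivatives and Laplacian -/

section Lift

variable (F : Type*) [NormedAddCommGroup F] [InnerProductSpace ℝ F]

/-- The inner product as a continuous bilinear map. -/
def innerCLM : F →L[ℝ] F →L[ℝ] ℝ := (innerSL ℝ : F →L[ℝ] F →L[ℝ] ℝ)

variable {F}

theorem innerCLM_apply (x y : F) : innerCLM F x y = inner ℝ x y := rfl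

theorem norm_innerCLM_apply (x : F) : ‖innerCLM F x‖ = ‖x‖ := innerSL_apply_norm ℝ x

theorem norm_innerCLM_le : ‖innerCLM F‖ ≤ 1 :=
  ContinuousLinearMap.opNorm_le_bound _ zero_le_one fun x => by
    rw [norm_innerCLM_apply, one_mul]

/-- The derivative of the radial function with profile `-P`, where `P'' + (n/r) P' = h`. -/
def radialGradient (n : ℕ) (h : ℝ → ℝ) (x : F) : F →L[ℝ] ℝ :=
  -radialMean n h ‖x‖ • innerCLM F x

/-- The second derivative of the radial function with profile `-P`, where
`P'' + (n/r) P' = h`. -/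
def radialHessian (n : ℕ) (h : ℝ → ℝ) (x : F) : F →L[ℝ] F →L[ℝ] ℝ :=
  -radialMean n h ‖x‖ • innerCLM F -
    ((h ‖x‖ - (n + 1) * radialMean n h ‖x‖) / ‖x‖ ^ 2) • (innerCLM F x).smulRight (innerCLM F x)

theorem norm_smulRight_innerCLM (x : F) :
    ‖(innerCLM F x).smulRight (innerCLM F x)‖ = ‖x‖ ^ 2 := by
  rw [ContinuousLinearMap.norm_smulRight_apply, norm_innerCLM_apply, sq]

theorem norm_radialGradient_sub (n : ℕ) (h k : ℝ → ℝ) (x : F) :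
    ‖radialGradient n h x - radialGradient n k x‖ =
      |‖x‖ * radialMean n h ‖x‖ - ‖x‖ * radialMean n k ‖x‖| := by
  have e : radialGradient n h x - radialGradient n k x =
      (-(radialMean n h ‖x‖ - radialMean n k ‖x‖)) • innerCLM F x := by
    ext y
    simp only [radialGradient, sub_apply, smul_apply, smul_eq_mul]
    ring
  rw [e, norm_smul, norm_innerCLM_apply, ← mul_sub, abs_mul, abs_norm, mul_comm, norm_neg,
    Real.norm_eq_abs]

/-- The rank-one operator has norm `‖x‖²`, which cancels the singular denominator; at the origin the
term is zero. -/
theorem norm_div_sq_smul_le (c : ℝ) (x : F) :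
    ‖(c / ‖x‖ ^ 2) • (innerCLM F x).smulRight (innerCLM F x)‖ ≤ |c| := by
  refine (ContinuousLinearMap.opNorm_smul_le _ _).trans ?_
  rw [norm_smulRight_innerCLM, norm_div, norm_pow, norm_norm, Real.norm_eq_abs]
  rcases eq_or_ne ‖x‖ 0 with hx | hx
  · simp [hx]
  · rw [div_mul_cancel₀ _ (pow_ne_zero _ hx)]

theorem norm_radialHessian_sub_le (n : ℕ) (h k : ℝ → ℝ) (x : F) :
    ‖radialHessian n h x - radialHessian n k x‖ ≤
      |h ‖x‖ - k ‖x‖| + (n + 2) * |radialMean n h ‖x‖ - radialMean n k ‖x‖| := by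
  set r := ‖x‖
  have e : radialHessian n h x - radialHessian n k x =
      (-(radialMean n h r - radialMean n k r)) • innerCLM F -
      ((h r - k r - (n + 1) * (radialMean n h r - radialMean n k r)) / ‖x‖ ^ 2) •
        (innerCLM F x).smulRight (innerCLM F x) := by
    ext y z
    simp only [radialHessian, sub_apply, smul_apply, smul_eq_mul]
    ring
  rw [e]
  refine (norm_sub_le (E := F →L[ℝ] F →L[ℝ] ℝ) _ _).trans
    ((add_le_add (ContinuousLinearMap.opNorm_smul_le _ _) (norm_div_sq_smul_le _ x)).trans ?_)
  rw [norm_neg, Real.norm_eq_abs]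
  have h1 := mul_le_mul_of_nonneg_left (norm_innerCLM_le (F := F))
    (abs_nonneg (radialMean n h r - radialMean n k r))
  have h2 := abs_sub (h r - k r) ((n + 1) * (radialMean n h r - radialMean n k r))
  rw [abs_mul (n + 1 : ℝ), abs_of_nonneg (by positivity : (0 : ℝ) ≤ n + 1)] at h2
  linarith

theorem hasFDerivAt_norm {x : F} (hx : x ≠ 0) :
    HasFDerivAt (fun y : F => ‖y‖) (‖x‖⁻¹ • innerCLM F x) x := by
  have hx' : ‖x‖ ≠ 0 := norm_ne_zero_iff.2 hx
  have h1 := (hasStrictFDerivAt_norm_sq x).hasFDerivAt.sqrt (pow_ne_zero 2 hx')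
  simp only [Real.sqrt_sq (norm_nonneg _)] at h1
  refine h1.congr_fderiv ?_
  ext y
  simp only [smul_apply, smul_eq_mul, innerCLM_apply, nsmul_eq_mul,
    innerSL_apply_apply]
  field_simp
  norm_num

/-- At the origin the coefficient `h - (n+1) m` of the rank-one part tends to zero, because `m(0) =
h(0)/(n+1)`. -/
theorem continuous_radialHessian (n : ℕ) {h : ℝ → ℝ} (hh : Continuous h) :
    Continuous (radialHessian n h : F → F →L[ℝ] F →L[ℝ] ℝ) := by
  have hm := continuous_radialMean n hh
  have h0 : Continuous fun x : F => -radialMean n h ‖x‖ • innerCLM F :=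
    (hm.comp continuous_norm).neg.smul continuous_const
  have : ContinuousSub (F →L[ℝ] F →L[ℝ] ℝ) :=
    @IsTopologicalAddGroup.to_continuousSub (F →L[ℝ] F →L[ℝ] ℝ) _ inferInstance inferInstance
  refine h0.sub (continuous_iff_continuousAt.2 fun x => ?_)
  rcases eq_or_ne x 0 with rfl | hx
  · rw [ContinuousAt, map_zero]
    have h0 : Continuous fun x : F => |h ‖x‖ - (n + 1) * radialMean n h ‖x‖| := by fun_prop
    have h1 := h0.tendsto 0
    rw [norm_zero, radialMean_zero] at h1
    have h2 : |h 0 - (n + 1) * (h 0 / (n + 1))| = 0 := by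
      rw [abs_eq_zero]
      field_simp
      ring
    rw [h2] at h1
    have h3 : ((h ‖(0 : F)‖ - (n + 1) * radialMean n h ‖(0 : F)‖) / ‖(0 : F)‖ ^ 2) •
        ContinuousLinearMap.smulRight (0 : F →L[ℝ] ℝ) (0 : F →L[ℝ] ℝ) = 0 := by
      ext y z
      simp
    rw [h3]
    refine tendsto_zero_iff_norm_tendsto_zero (E := F →L[ℝ] F →L[ℝ] ℝ) |>.2 ?_
    exact squeeze_zero (fun _ => norm_nonneg _) (fun x => norm_div_sq_smul_le _ x) h1
  · have hx' : ‖x‖ ^ 2 ≠ 0 := pow_ne_zero _ (norm_ne_zero_iff.2 hx)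
    have h1 : ContinuousAt
        (fun x : F => (h ‖x‖ - (n + 1) * radialMean n h ‖x‖) / ‖x‖ ^ 2) x :=
      ContinuousAt.div (by fun_prop) (by fun_prop) hx'
    have h2 : Continuous fun x : F => (innerCLM F x).smulRight (innerCLM F x) :=
      (ContinuousLinearMap.smulRightL ℝ F (F →L[ℝ] ℝ)).continuous₂.comp
        ((innerCLM F).continuous.prodMk (innerCLM F).continuous)
    exact h1.smul h2.continuousAt

theorem hasFDerivAt_radialGradient (n : ℕ) {h : ℝ → ℝ} (hh : Continuous h) (x : F) :
    HasFDerivAt (radialGradient n h) (radialHessian n h x) x := by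
  rcases eq_or_ne x 0 with rfl | hx
  · have h0 : radialHessian n h 0 = -radialMean n h 0 • innerCLM F := by
      ext y z
      simp [radialHessian]
    have hm : Continuous fun x : F => radialMean n h ‖x‖ :=
      (continuous_radialMean n hh).comp continuous_norm
    rw [h0, hasFDerivAt_iff_isLittleO_nhds_zero]
    -- The mean need not be differentiable at `0`: its `o(1)` increment times the `O(‖x‖)` factor is
    -- already `o(‖x‖)`.
    have h1 : (fun x : F => radialMean n h ‖x‖ - radialMean n h 0) =o[𝓝 0]
        fun _ => (1 : ℝ) := by
      rw [Asymptotics.isLittleO_one_iff]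
      simpa using (hm.tendsto 0).sub_const (radialMean n h 0)
    have h2 : (fun x : F => innerCLM F x) =O[𝓝 0] fun x => x :=
      (innerCLM F).isBigO_id _
    have h3 := (h1.neg_left.smul_isBigO h2)
    simp only [one_smul] at h3
    refine h3.congr_left fun x => ?_
    simp only [radialGradient, zero_add, map_zero, smul_zero, sub_zero,
      smul_apply]
    module
  · have hx' : ‖x‖ ≠ 0 := norm_ne_zero_iff.2 hx
    have h1 := ((hasDerivAt_radialMean n hh hx').neg.comp_hasFDerivAt x
      (hasFDerivAt_norm hx)).smul (innerCLM F).hasFDerivAt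
    refine h1.congr_fderiv ?_
    ext y z
    simp only [radialHessian, add_apply, sub_apply,
      smul_apply, ContinuousLinearMap.smulRight_apply, smul_eq_mul,
      Function.comp, Pi.neg_apply]
    field_simp
    ring

namespace IsRadialProfile

variable {n : ℕ} {g : ℝ → ℝ} {α : ℝ} {u : ℝ → ℝ}

theorem hasFDerivAt (hu : IsRadialProfile n g α u) (x : F) :
    HasFDerivAt (fun x : F => u ‖x‖) (radialGradient n (g ∘ u) x) x := by
  rcases eq_or_ne x 0 with rfl | hx
  · have h0 : radialGradient n (g ∘ u) (0 : F) = 0 := by simp [radialGradient]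
    have h1 := hu.hasDerivAt 0
    rw [zero_mul, neg_zero, hasDerivAt_iff_isLittleO_nhds_zero] at h1
    rw [h0, hasFDerivAt_iff_isLittleO_nhds_zero]
    have h2 : Tendsto (fun x : F => ‖x‖) (𝓝 0) (𝓝 0) := by
      simpa using (continuous_norm (E := F)).tendsto 0
    simpa [Function.comp_def] using (h1.comp_tendsto h2).of_norm_right
  · refine ((hu.hasDerivAt ‖x‖).comp_hasFDerivAt x (hasFDerivAt_norm hx)).congr_fderiv ?_
    have hx' : ‖x‖ ≠ 0 := norm_ne_zero_iff.2 hx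
    rw [radialGradient, smul_smul]
    congr 1
    field_simp

theorem fderiv_eq (hu : IsRadialProfile n g α u) :
    fderiv ℝ (fun x : F => u ‖x‖) = radialGradient n (g ∘ u) :=
  funext fun x => (hu.hasFDerivAt x).fderiv

theorem fderiv_fderiv_eq (hu : IsRadialProfile n g α u) (hg : Continuous g) :
    fderiv ℝ (fderiv ℝ (fun x : F => u ‖x‖)) = radialHessian n (g ∘ u) := by
  rw [hu.fderiv_eq]
  exact funext fun x => (hasFDerivAt_radialGradient n (hg.comp hu.continuous) x).fderiv

theorem contDiff (hu : IsRadialProfile n g α u) (hg : Continuous g) :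
    ContDiff ℝ 2 fun x : F => u ‖x‖ := by
  have h2 : (2 : WithTop ℕ∞) = 1 + 1 := by norm_num
  rw [h2, contDiff_succ_iff_fderiv]
  refine ⟨fun x => (hu.hasFDerivAt x).differentiableAt, by simp, ?_⟩
  rw [contDiff_one_iff_fderiv, hu.fderiv_fderiv_eq hg, hu.fderiv_eq]
  exact ⟨fun x =>
    (hasFDerivAt_radialGradient n (hg.comp hu.continuous) x).differentiableAt,
    continuous_radialHessian n (hg.comp hu.continuous)⟩

/-- In the trace, the inner product contributes `n + 1` and the rank-one part `‖x‖²`, so the means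
cancel and only `-h` remains. -/
theorem laplacian_eq [FiniteDimensional ℝ F] (hu : IsRadialProfile n g α u) (hg : Continuous g)
    (hF : Module.finrank ℝ F = n + 1) (x : F) :
    Laplacian.laplacian (fun x : F => u ‖x‖) x = -g (u ‖x‖) := by
  set v := stdOrthonormalBasis ℝ F
  rw [InnerProductSpace.laplacian_eq_iteratedFDeriv_orthonormalBasis _ v]
  simp only [iteratedFDeriv_two_apply, hu.fderiv_fderiv_eq hg]
  simp only [radialHessian, Matrix.cons_val_zero, Matrix.cons_val_one, sub_apply, smul_apply,
    ContinuousLinearMap.smulRight_apply, smul_eq_mul, innerCLM_apply]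
  have h1 : ∑ i, inner ℝ x (v i) * inner ℝ x (v i) = ‖x‖ ^ 2 := by
    rw [← v.sum_sq_inner_left x]
    simp only [sq]
  rw [Finset.sum_sub_distrib, ← Finset.mul_sum, ← Finset.mul_sum, h1]
  have h2 : ∑ i, inner ℝ (v i) (v i) = (n + 1 : ℝ) := by
    simp [hF]
  rw [h2]
  rcases eq_or_ne ‖x‖ 0 with hx | hx
  · rw [hx, radialMean_zero]
    simp only [Function.comp]
    field_simp
    ring
  · simp only [Function.comp]
    field_simp
    ring

end IsRadialProfile

end Lift

/-! ### Convergence and connectedness in `C²`; sup norms -/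

theorem tendsto_c2Topology {N : ℕ} {S : Set (Set (E N))} {l : Filter ℝ} {U : ℝ → C2 N} {w : C2 N}
    (h : ∀ K ∈ S, ∀ ε > 0, ∀ᶠ β in l, ∀ x ∈ K, |U β x - w x| < ε ∧
      ‖fderiv ℝ (U β) x - fderiv ℝ w x‖ < ε ∧
      ‖fderiv ℝ (fderiv ℝ (U β)) x - fderiv ℝ (fderiv ℝ w) x‖ < ε) :
    Tendsto U l (@nhds _ (c2Topology N S) w) := by
  unfold c2Topology
  simp only [nhds_inf, tendsto_inf, nhds_induced, tendsto_comap_iff,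
    UniformOnFun.tendsto_iff_tendstoUniformlyOn]
  refine ⟨⟨fun K hK => ?_, fun K hK => ?_⟩, fun K hK => ?_⟩
  · refine Metric.tendstoUniformlyOn_iff.2 fun ε hε => ?_
    filter_upwards [h K hK ε hε] with β hβ x hx
    rw [dist_comm, Real.dist_eq]
    exact (hβ x hx).1
  · refine Metric.tendstoUniformlyOn_iff.2 fun ε hε => ?_
    filter_upwards [h K hK ε hε] with β hβ x hx
    rw [dist_comm, dist_eq_norm]
    exact (hβ x hx).2.1
  · refine Metric.tendstoUniformlyOn_iff (α := E N →L[ℝ] E N →L[ℝ] ℝ).2 fun ε hε => ?_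
    filter_upwards [h K hK ε hε] with β hβ x hx
    have h1 := (hβ x hx).2.2
    exact (dist_comm _ _).trans_lt ((dist_eq_norm (E := E N →L[ℝ] E N →L[ℝ] ℝ) _ _).trans_lt h1)

theorem isConnected_image_c2 {N : ℕ} {S : Set (Set (E N))} {U : ℝ → C2 N} {α₀ : EReal}
    (hα₀ : 0 < α₀)
    (h : ∀ α : ℝ, ((|α| : ℝ) : EReal) < α₀ → ∀ K ∈ S, ∀ ε > 0, ∃ δ > 0, ∀ β : ℝ,
      ((|β| : ℝ) : EReal) < α₀ → |β - α| < δ → ∀ x ∈ K, |U β x - U α x| < ε ∧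
      ‖fderiv ℝ (U β) x - fderiv ℝ (U α) x‖ < ε ∧
      ‖fderiv ℝ (fderiv ℝ (U β)) x - fderiv ℝ (fderiv ℝ (U α)) x‖ < ε) :
    @IsConnected (C2 N) (c2Topology N S) (U '' {α : ℝ | ((|α| : ℝ) : EReal) < α₀}) := by
  let _ := c2Topology N S
  have hD : IsConnected {α : ℝ | ((|α| : ℝ) : EReal) < α₀} := by
    refine ⟨⟨0, by simpa using hα₀⟩, Set.OrdConnected.isPreconnected ⟨fun x hx y hy z hz => ?_⟩⟩
    have hz' : |z| ≤ max |x| |y| := abs_le_max_abs_abs hz.1 hz.2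
    have : ((|z| : ℝ) : EReal) ≤ ((max |x| |y| : ℝ) : EReal) := EReal.coe_le_coe_iff.2 hz'
    refine this.trans_lt ?_
    rcases max_choice |x| |y| with h | h <;> rw [h]
    exacts [hx, hy]
  refine hD.image U fun α hα => tendsto_c2Topology fun K hK ε hε => ?_
  obtain ⟨δ, hδ, h1⟩ := h α hα K hK ε hε
  filter_upwards [self_mem_nhdsWithin,
    mem_nhdsWithin_of_mem_nhds (Metric.ball_mem_nhds α hδ)] with β hβ hβδ
  exact h1 β hβ (by simpa [Real.dist_eq] using hβδ)

/-- The almost everywhere bound holds on a dense set, which is closed by continuity, so it reaches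
the origin where the maximum is attained. -/
theorem eLpNorm_top_eq_of_continuous {N : ℕ} {f : E N → ℝ} (hf : Continuous f) {c : ℝ}
    (hle : ∀ x, |f x| ≤ |c|) (h0 : f 0 = c) :
    eLpNorm f ∞ volume = ENNReal.ofReal |c| := by
  rw [eLpNorm_exponent_top]
  refine le_antisymm (eLpNormEssSup_le_of_ae_bound (.of_forall fun x => hle x)) ?_
  have hae : ∀ᵐ x, ‖f x‖ₑ ≤ eLpNormEssSup f volume := ae_le_eLpNormEssSup
  have hcl : IsClosed {x | ‖f x‖ₑ ≤ eLpNormEssSup f volume} :=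
    isClosed_le hf.enorm continuous_const
  have huniv : (0 : E N) ∈ {x | ‖f x‖ₑ ≤ eLpNormEssSup f volume} := by
    rw [← hcl.closure_eq]
    exact (Measure.dense_of_ae hae) 0
  have h1 : ‖f 0‖ₑ ≤ eLpNormEssSup f volume := huniv
  rwa [h0, ← ofReal_norm, Real.norm_eq_abs] at h1

theorem abs_le_mul_abs_of_bounds {g : ℝ → ℝ} (hg0 : g 0 = 0) {a b z : ℝ} (ha : 0 < a)
    (h : a * z ^ 2 ≤ z * g z ∧ z * g z ≤ b * z ^ 2) : |g z| ≤ b * |z| := by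
  rcases eq_or_ne z 0 with rfl | hz
  · simp [hg0]
  · refine le_of_mul_le_mul_left ?_ (abs_pos.2 hz)
    rw [← abs_mul, abs_of_nonneg ((by positivity : 0 ≤ a * z ^ 2).trans h.1)]
    have : b * z ^ 2 = |z| * (b * |z|) := by
      rw [← sq_abs]
      ring
    linarith [h.2]

/-! ### Periodicity in dimension one and two-sided decay -/

namespace IsRadialProfile

variable {n : ℕ} {g : ℝ → ℝ} {α A a b : ℝ} {u : ℝ → ℝ}

theorem isDampedOscillation (hu : IsRadialProfile n g α u) (hg : Continuous g)
    (hodd : ∀ z, g (-z) = -g z) (ha : 0 < a) (hab : a ≤ b)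
    (hbd : ∀ z, |z| ≤ A → a * z ^ 2 ≤ z * g z ∧ z * g z ≤ b * z ^ 2) (huA : ∀ r, |u r| ≤ A) :
    IsDampedOscillation n g (primitive g) u (deriv u) a b where
  pos := ha
  le := hab
  hasDerivAt_left r _ := hu.deriv_eq ▸ hu.hasDerivAt r
  hasDerivAt_right r hr := by
    rw [hu.deriv_eq]
    refine (hu.hasDerivAt_deriv hg r).congr_deriv ?_
    field_simp
  hasDerivAt_primitive := hasDerivAt_primitive hg
  bounds r _ := hbd _ (huA r)
  primitive_bounds r _ := primitive_bounds hg hodd hbd (huA r)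

/-- For `n = 0` the equation is autonomous, and uniqueness makes `u` odd about its zero `z`. With
evenness about `0`, translation by `2z` changes the sign of `u`. -/
theorem periodic (hu : IsRadialProfile 0 g α u) (hg : ContDiff ℝ 1 g)
    (hodd : ∀ z, g (-z) = -g z) (huA : ∀ r, |u r| ≤ A) {z : ℝ} (hz : u z = 0) :
    Function.Periodic u (4 * z) := by
  obtain ⟨L, hL, hLip⟩ := exists_lipschitz_bound hg A
  have hd1 : ∀ r, HasDerivAt u (deriv u r) r := fun r => hu.deriv_eq ▸ hu.hasDerivAt r
  have hd2 : ∀ r, HasDerivAt (deriv u) (-g (u r)) r := fun r => by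
    rw [hu.deriv_eq]
    exact (hu.hasDerivAt_deriv hg.continuous r).congr_deriv (by simp)
  have hrefl : ∀ r : ℝ, HasDerivAt (fun r => 2 * z - r) (-1) r := fun r =>
    (hasDerivAt_id r).const_sub (2 * z)
  have key : (fun r => (u r, deriv u r)) = fun r => (-u (2 * z - r), deriv u (2 * z - r)) := by
    refine ODE_solution_unique_univ (v := fun _ p => (p.2, -g p.1)) (s := fun _ => {p | |p.1| ≤ A})
      (K := max 1 L.toNNReal) (t₀ := z) (fun t => ?_) (fun t => ⟨?_, huA t⟩)
      (fun t => ⟨?_, by simpa using huA (2 * z - t)⟩) ?_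
    · refine LipschitzOnWith.of_dist_le_mul fun p hp q hq => ?_
      have h1 : dist p.2 q.2 ≤ dist p q := le_max_right _ _
      have h2 : dist p.1 q.1 ≤ dist p q := le_max_left _ _
      rw [Prod.dist_eq, NNReal.coe_max, Real.coe_toNNReal L hL, NNReal.coe_one]
      refine max_le ?_ ?_
      · exact h1.trans (le_mul_of_one_le_left dist_nonneg (le_max_left _ _))
      · rw [dist_neg_neg]
        refine (hLip _ _ hp hq).trans ?_
        rw [← Real.dist_eq]
        gcongr
        exact le_max_right _ _
    · exact (hd1 t).prodMk (hd2 t)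
    · refine (((hd1 (2 * z - t)).comp t (hrefl t)).neg.congr_deriv ?_).prodMk
        (((hd2 (2 * z - t)).comp t (hrefl t)).congr_deriv ?_)
      · ring
      · rw [hodd]
        ring
    · have : 2 * z - z = z := by ring
      simp [this, hz]
  have hsym : ∀ r, u r = -u (2 * z - r) := fun r => congrArg Prod.fst (congrFun key r)
  intro r
  rw [hsym, ← hu.even, hsym, neg_neg, ← hu.even r]
  congr 1
  ring

theorem energy_pos (hu : IsRadialProfile n g α u) (hg : Continuous g)
    (hosc : IsDampedOscillation n g (primitive g) u (deriv u) a b) (hα : 0 < primitive g α)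
    {r : ℝ} (hr : 0 < r) : 0 < deriv u r ^ 2 / 2 + primitive g (u r) := by
  have h0 : 0 < deriv u 0 ^ 2 / 2 + primitive g (u 0) := by
    simpa [hu.deriv_eq, hu.zero] using hα
  have h1 := (hu.hasDerivAt_energy hg 0).continuousAt.eventually (lt_mem_nhds h0)
  -- The monotone quantity `r^(2n) E` vanishes at `0` when `n ≥ 1`, so a positive starting point `s`
  -- near `0` is needed.
  obtain ⟨s, hs, hs0⟩ := ((h1.filter_mono nhdsWithin_le_nhds).and
    (Ioc_mem_nhdsGT hr : Ioc 0 r ∈ 𝓝[>] (0 : ℝ))).exists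
  have h2 := hosc.pow_mul_energy_le hs0.1 hs0.2
  have h3 : 0 < s ^ (2 * n) * (deriv u s ^ 2 / 2 + primitive g (u s)) :=
    mul_pos (pow_pos hs0.1 _) hs
  exact pos_of_mul_pos_right (h3.trans_le h2) (pow_nonneg hr.le _)

-- Beyond `R` the bounds on `rⁿ E` apply, and on `[1, R]` monotonicity of `E` replaces them. The
-- energy is comparable to `u² + u'²`, and the equation controls `u''`.
set_option maxHeartbeats 800000 in
theorem exists_decay_bounds (hu : IsRadialProfile n g α u) (hg : Continuous g) (hg0 : g 0 = 0)
    (hosc : IsDampedOscillation n g (primitive g) u (deriv u) a b) (hα : 0 < primitive g α)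
    (hn : 1 ≤ n) {σ C : ℝ} (hσ : 0 < σ) (hC : 0 ≤ C)
    (hH : ∀ r, |2 * primitive g (u r) - u r * g (u r)| ≤ C * (|u r| ^ σ * u r ^ 2)) :
    ∃ c C : ℝ, 0 < c ∧ 0 < C ∧ ∀ r : ℝ, 1 ≤ r →
      c * r ^ (-(n : ℝ) / 2) ≤ |u r| + |deriv u r| + |deriv (deriv u) r| ∧
      |u r| + |deriv u r| + |deriv (deriv u) r| ≤ C * r ^ (-(n : ℝ) / 2) := by
  have ha := hosc.pos
  have hb : 0 < b := ha.trans_le hosc.le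
  obtain ⟨c₀, K₀, R, hc₀, hK₀, hR, hbd⟩ := hosc.exists_pow_mul_energy_bounds hn hσ hC
    (fun r _ => hH r) (fun r hr => hu.energy_pos hg hosc hα hr)
  set e : ℝ → ℝ := fun r => deriv u r ^ 2 / 2 + primitive g (u r) with he
  have heR : 0 < e R := hu.energy_pos hg hosc hα (by linarith)
  set c₁ := min c₀ (e R) with hc₁
  set K₁ := max K₀ (R ^ n * primitive g α) with hK₁
  have hc₁0 : 0 < c₁ := lt_min hc₀ heR
  have hK₁0 : 0 < K₁ := hK₀.trans_le (le_max_left _ _)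
  have hbd' : ∀ r, 1 ≤ r → c₁ ≤ r ^ n * e r ∧ r ^ n * e r ≤ K₁ := by
    intro r hr
    rcases le_total R r with h | h
    · exact ⟨(min_le_left _ _).trans (hbd r h).1, (hbd r h).2.trans (le_max_left _ _)⟩
    · have h1 : e R ≤ e r := hu.antitoneOn_energy hg (mem_Ici.2 (by linarith))
        (mem_Ici.2 (by linarith)) h
      have h2 : e r ≤ primitive g α := hu.energy_le hg (by linarith)
      have h3 : 1 ≤ r ^ n := one_le_pow₀ hr
      have h4 : r ^ n ≤ R ^ n := pow_le_pow_left₀ (by linarith) h n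
      refine ⟨(min_le_right _ _).trans (h1.trans (le_mul_of_one_le_left (by linarith) h3)),
        le_trans ?_ (le_max_right _ _)⟩
      exact mul_le_mul h4 h2 (by linarith) (by positivity)
  refine ⟨Real.sqrt (2 / (1 + b) * c₁), (1 + n + b) * Real.sqrt ((4 / a + 4) * K₁),
    by positivity, by positivity, fun r hr => ?_⟩
  have hr0 : 0 < r := by linarith
  obtain ⟨h1, h2⟩ := hbd' r hr
  obtain ⟨h3, h4, -, h5⟩ := hosc.energy_bounds hr0
  change u r ^ 2 ≤ 2 / a * e r at h3
  change deriv u r ^ 2 ≤ 2 * e r at h4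
  change e r ≤ (1 + b) / 2 * (u r ^ 2 + deriv u r ^ 2) at h5
  set s := r ^ (-(n : ℝ) / 2) with hs
  have hs0 : 0 < s := Real.rpow_pos_of_pos hr0 _
  have hs2 : r ^ n * s ^ 2 = 1 := by
    rw [hs, ← Real.rpow_natCast (r ^ _) 2, ← Real.rpow_mul hr0.le, ← Real.rpow_natCast r n,
      ← Real.rpow_add hr0]
    push_cast
    rw [div_mul_cancel₀ _ two_ne_zero, add_neg_cancel, Real.rpow_zero]
  have hes : e r = r ^ n * e r * s ^ 2 := by
    rw [mul_right_comm, hs2, one_mul]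
  have h6 : c₁ * s ^ 2 ≤ e r := by
    rw [hes]
    gcongr
  have h7 : e r ≤ K₁ * s ^ 2 := by
    rw [hes]
    gcongr
  have hlow : Real.sqrt (2 / (1 + b) * c₁) * s ≤ |u r| + |deriv u r| := by
    refine (pow_le_pow_iff_left₀ (by positivity) (by positivity) two_ne_zero).1 ?_
    rw [mul_pow, Real.sq_sqrt (by positivity)]
    calc 2 / (1 + b) * c₁ * s ^ 2 = 2 / (1 + b) * (c₁ * s ^ 2) := by ring
      _ ≤ 2 / (1 + b) * ((1 + b) / 2 * (u r ^ 2 + deriv u r ^ 2)) := by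
        exact mul_le_mul_of_nonneg_left (h6.trans h5) (by positivity)
      _ = u r ^ 2 + deriv u r ^ 2 := by field_simp
      _ ≤ _ := by
        rw [← sq_abs (u r), ← sq_abs (deriv u r)]
        nlinarith [mul_nonneg (abs_nonneg (u r)) (abs_nonneg (deriv u r))]
  have hup : |u r| + |deriv u r| ≤ Real.sqrt ((4 / a + 4) * K₁) * s := by
    refine (pow_le_pow_iff_left₀ (by positivity) (by positivity) two_ne_zero).1 ?_
    rw [mul_pow, Real.sq_sqrt (by positivity)]
    calc (|u r| + |deriv u r|) ^ 2 ≤ 2 * (u r ^ 2 + deriv u r ^ 2) := by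
          rw [← sq_abs (u r), ← sq_abs (deriv u r)]
          nlinarith [sq_nonneg (|u r| - |deriv u r|)]
      _ ≤ 2 * (2 / a * e r + 2 * e r) := by gcongr
      _ = (4 / a + 4) * e r := by ring
      _ ≤ (4 / a + 4) * (K₁ * s ^ 2) := by gcongr
      _ = _ := by ring
  have hdd : |deriv (deriv u) r| ≤ n * |deriv u r| + b * |u r| := by
    rw [(hosc.hasDerivAt_right r hr0).deriv]
    refine (abs_sub _ _).trans (add_le_add ?_ ?_)
    · rw [abs_mul, abs_neg, abs_of_nonneg (by positivity : (0 : ℝ) ≤ n / r)]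
      gcongr
      exact div_le_self (by positivity) hr
    · exact abs_le_mul_abs_of_bounds hg0 ha (hosc.bounds r hr0)
  constructor
  · linarith [abs_nonneg (deriv (deriv u) r)]
  · have h10 : |u r| + |deriv u r| + |deriv (deriv u) r| ≤
        (1 + n + b) * (|u r| + |deriv u r|) := by
      have : (0 : ℝ) ≤ n := Nat.cast_nonneg n
      linarith [abs_nonneg (u r), abs_nonneg (deriv u r),
        mul_nonneg this (abs_nonneg (u r)), mul_nonneg hb.le (abs_nonneg (deriv u r))]
    calc _ ≤ (1 + n + b) * (|u r| + |deriv u r|) := h10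
      _ ≤ (1 + n + b) * (Real.sqrt ((4 / a + 4) * K₁) * s) := by gcongr
      _ = _ := by ring

end IsRadialProfile

/-! ### Continuity in the central value, locally and near infinity -/

namespace IsRadialProfile

variable {n : ℕ} {g : ℝ → ℝ} {α β A a b : ℝ} {u v : ℝ → ℝ}

theorem norm_fderiv_sub {F : Type*} [NormedAddCommGroup F] [InnerProductSpace ℝ F]
    (hu : IsRadialProfile n g α u) (hv : IsRadialProfile n g β v) (x : F) :
    ‖fderiv ℝ (fun x : F => u ‖x‖) x - fderiv ℝ (fun x : F => v ‖x‖) x‖ =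
      |deriv u ‖x‖ - deriv v ‖x‖| := by
  rw [hu.fderiv_eq, hv.fderiv_eq, norm_radialGradient_sub, hu.deriv_eq, hv.deriv_eq, ← abs_neg]
  congr 1
  ring

theorem norm_fderiv_fderiv_sub_le {F : Type*} [NormedAddCommGroup F] [InnerProductSpace ℝ F]
    (hu : IsRadialProfile n g α u) (hv : IsRadialProfile n g β v) (hg : Continuous g) (x : F) :
    ‖fderiv ℝ (fderiv ℝ (fun x : F => u ‖x‖)) x - fderiv ℝ (fderiv ℝ (fun x : F => v ‖x‖)) x‖ ≤
      |g (u ‖x‖) - g (v ‖x‖)| +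
        (n + 2) * |radialMean n (g ∘ u) ‖x‖ - radialMean n (g ∘ v) ‖x‖| := by
  rw [hu.fderiv_fderiv_eq hg, hv.fderiv_fderiv_eq hg]
  exact norm_radialHessian_sub_le n (g ∘ u) (g ∘ v) x

/-- Continuous dependence of the profile on its value at the origin, locally uniformly. -/
theorem exists_local_bound (n : ℕ) (hg : ContDiff ℝ 1 g) (A R : ℝ) :
    ∃ K : ℝ, 0 ≤ K ∧ ∀ {α β : ℝ} {u v : ℝ → ℝ}, IsRadialProfile n g α u →
      IsRadialProfile n g β v → (∀ r, |u r| ≤ A) → (∀ r, |v r| ≤ A) → ∀ r, 0 ≤ r → r ≤ R →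
      |u r - v r| ≤ K * |α - β| ∧ |deriv u r - deriv v r| ≤ K * |α - β| ∧
      |g (u r) - g (v r)| + (n + 2) * |radialMean n (g ∘ u) r - radialMean n (g ∘ v) r| ≤
        K * |α - β| := by
  obtain ⟨L, hL, hLip⟩ := exists_lipschitz_bound hg A
  set l : ℝ := 2 * L + 1 with hl
  have hl0 : 0 < l := by positivity
  have hl2 : L / l ^ 2 ≤ 1 / 2 := by
    rw [div_le_div_iff₀ (by positivity) two_pos]
    nlinarith
  set c : ℝ := 2 * Real.exp (l * R) with hc
  have hc0 : 0 ≤ c := by positivity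
  refine ⟨c * (1 + |R| * L + (n + 3) * L), by positivity,
    fun {α β u v} hu hv huA hvA r hr hrR => ?_⟩
  set d := |α - β| with hd
  have hd0 : 0 ≤ d := abs_nonneg _
  have h1 : ∀ s, 0 ≤ s → s ≤ r → |u s - v s| ≤ c * d := by
    intro s hs hsr
    refine (hu.abs_sub_le hv hg.continuous hL hl0 hl2 hLip huA hvA hs).trans ?_
    have : Real.exp (l * s) ≤ Real.exp (l * R) := Real.exp_le_exp.2 (by gcongr; linarith)
    calc 2 * d * Real.exp (l * s) ≤ 2 * d * Real.exp (l * R) := by gcongr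
      _ = c * d := by rw [hc]; ring
  have h2 : ∀ s, 0 ≤ s → s ≤ r → |g (u s) - g (v s)| ≤ L * (c * d) := fun s hs hsr =>
    (hLip _ _ (huA s) (hvA s)).trans (mul_le_mul_of_nonneg_left (h1 s hs hsr) hL)
  have h3 : |radialMean n (g ∘ u) r - radialMean n (g ∘ v) r| ≤ L * (c * d) := by
    rw [← radialMean_sub n (hg.continuous.comp hu.continuous) (hg.continuous.comp hv.continuous)]
    exact abs_radialMean_le n hr h2
  have h4 : |deriv u r - deriv v r| ≤ |R| * (L * (c * d)) := by
    have e : deriv u r - deriv v r =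
        -(r * (radialMean n (g ∘ u) r - radialMean n (g ∘ v) r)) := by
      rw [hu.deriv_eq, hv.deriv_eq]
      ring
    rw [e, abs_neg, abs_mul, abs_of_nonneg hr]
    have : r ≤ |R| := hrR.trans (le_abs_self R)
    gcongr
  have p1 : 0 ≤ c * d := by positivity
  have p2 : 0 ≤ |R| * (L * (c * d)) := by positivity
  have p3 : 0 ≤ (n + 3) * (L * (c * d)) := by positivity
  have e : c * (1 + |R| * L + (n + 3) * L) * d =
      c * d + |R| * (L * (c * d)) + (n + 3) * (L * (c * d)) := by ring
  rw [e]
  refine ⟨by linarith [h1 r hr le_rfl], by linarith, ?_⟩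
  have h5 : (n + 2) * |radialMean n (g ∘ u) r - radialMean n (g ∘ v) r| ≤
      (n + 2) * (L * (c * d)) := by gcongr
  linarith [h2 r hr le_rfl]

/-- Profiles with nearby values at the origin are uniformly close to each other near infinity. -/
theorem exists_tail_bound (hu : IsRadialProfile n g α u) (hg : ContDiff ℝ 1 g)
    (hodd : ∀ z, g (-z) = -g z) (hg0 : g 0 = 0) (hn : 1 ≤ n) (ha : 0 < a) (hab : a ≤ b)
    (hbd : ∀ z, |z| ≤ A → a * z ^ 2 ≤ z * g z ∧ z * g z ≤ b * z ^ 2) (huA : ∀ r, |u r| ≤ A)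
    {ε : ℝ} (hε : 0 < ε) :
    ∃ R δ : ℝ, 0 < δ ∧ ∀ {β : ℝ} {v : ℝ → ℝ}, IsRadialProfile n g β v → (∀ r, |v r| ≤ A) →
      |β - α| < δ → ∀ r, R ≤ r →
      |v r - u r| < ε ∧ |deriv v r - deriv u r| < ε ∧
      |g (v r) - g (u r)| + (n + 2) * |radialMean n (g ∘ v) r - radialMean n (g ∘ u) r| < ε := by
  have hb : 0 < b := ha.trans_le hab
  have hgc := hg.continuous
  -- If both profiles have size `η`, the last quantity is at most `(2b + 2n + 4) η`, strictly less
  -- than `ε`.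
  set η : ℝ := ε / (2 * b + 2 * n + 6) with hη
  have hη0 : 0 < η := by positivity
  have hηε : η * (2 * b + 2 * n + 6) = ε := by
    rw [hη]
    field_simp
  -- Energy at most `e'` forces `u² ≤ (2/a) e' ≤ η²` and `u'² ≤ 2 e' ≤ η²`.
  set e' : ℝ := η ^ 2 / (2 / a + 2) with he'
  have he'0 : 0 < e' := by positivity
  have he'η : (2 / a + 2) * e' = η ^ 2 := by
    rw [he']
    field_simp
  have hosc := hu.isDampedOscillation hgc hodd ha hab hbd huA
  obtain ⟨R, hRe, hR1⟩ := (((hosc.tendsto_energy hn).eventually (gt_mem_nhds he'0)).and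
    (eventually_ge_atTop 1)).exists
  -- Small energy at `R` is an open condition on `(u(R), u'(R))`, hence shared by profiles with
  -- nearby central values.
  have hΦ : Continuous fun q : ℝ × ℝ => q.2 ^ 2 / 2 + primitive g q.1 := by
    have : Continuous (primitive g) :=
      continuous_iff_continuousAt.2 fun z => (hasDerivAt_primitive hgc z).continuousAt
    fun_prop
  obtain ⟨ρ, hρ, hball⟩ := Metric.isOpen_iff.1 (hΦ.isOpen_preimage _ (isOpen_Iio (a := e')))
    (u R, deriv u R) hRe
  obtain ⟨K, hK, hloc⟩ := exists_local_bound n hg A R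
  have small : ∀ {γ : ℝ} {w : ℝ → ℝ}, IsRadialProfile n g γ w → (∀ r, |w r| ≤ A) →
      deriv w R ^ 2 / 2 + primitive g (w R) < e' → ∀ r, R ≤ r →
      |w r| ≤ η ∧ |deriv w r| ≤ η ∧ |g (w r)| ≤ b * η ∧ |radialMean n (g ∘ w) r| ≤ η := by
    intro γ w hw hwA hwe r hr
    have hr0 : 0 < r := by linarith
    have hosc' := hw.isDampedOscillation hgc hodd ha hab hbd hwA
    obtain ⟨h1, h2, -, -⟩ := hosc'.energy_bounds hr0
    have h3 := hosc'.energy_nonneg hr0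
    have h4 : deriv w r ^ 2 / 2 + primitive g (w r) ≤ e' :=
      (hw.antitoneOn_energy hgc (mem_Ici.2 (by linarith)) (mem_Ici.2 hr0.le) hr).trans hwe.le
    have h5 : 2 / a * (deriv w r ^ 2 / 2 + primitive g (w r)) ≤ 2 / a * e' := by gcongr
    have h6 : 0 ≤ 2 / a * e' := by positivity
    have h7 : |w r| ≤ η := abs_le_of_sq_le_sq (by linarith) hη0.le
    have h8 : |deriv w r| ≤ η := abs_le_of_sq_le_sq (by linarith) hη0.le
    refine ⟨h7, h8, (abs_le_mul_abs_of_bounds hg0 ha (hbd _ (hwA r))).trans (by gcongr), ?_⟩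
    rw [hw.deriv_eq, abs_neg, abs_mul, abs_of_pos hr0] at h8
    have : |radialMean n (g ∘ w) r| ≤ r * |radialMean n (g ∘ w) r| :=
      le_mul_of_one_le_left (abs_nonneg _) (by linarith)
    linarith
  refine ⟨R, ρ / (K + 1), by positivity, fun {β v} hv hvA hβ r hr => ?_⟩
  have hKρ : K * |β - α| < ρ := by
    rw [lt_div_iff₀ (by positivity)] at hβ
    nlinarith [abs_nonneg (β - α)]
  obtain ⟨c1, c2, -⟩ := hloc hv hu hvA huA R (by linarith) le_rfl
  have hve : deriv v R ^ 2 / 2 + primitive g (v R) < e' := by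
    refine hball (a := (v R, deriv v R)) ?_
    rw [Metric.mem_ball, Prod.dist_eq, max_lt_iff, Real.dist_eq, Real.dist_eq]
    exact ⟨c1.trans_lt hKρ, c2.trans_lt hKρ⟩
  obtain ⟨a1, a2, a3, a4⟩ := small hu huA hRe r hr
  obtain ⟨b1, b2, b3, b4⟩ := small hv hvA hve r hr
  have hbη : 0 < b * η := by positivity
  have hnη : 0 ≤ n * η := by positivity
  refine ⟨?_, ?_, ?_⟩
  · linarith [abs_sub (v r) (u r)]
  · linarith [abs_sub (deriv v r) (deriv u r)]
  · have h1 := abs_sub (g (v r)) (g (u r))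
    have h2 := abs_sub (radialMean n (g ∘ v) r) (radialMean n (g ∘ u) r)
    have h3 : (n + 2) * |radialMean n (g ∘ v) r - radialMean n (g ∘ u) r| ≤ (n + 2) * (2 * η) := by
      gcongr
      linarith
    linarith

end IsRadialProfile

/-! ### From profiles to the family of solutions on Euclidean space -/

theorem profile_eq {N : ℕ} [NeZero N] {u : ℝ → ℝ} (heven : ∀ r, u (-r) = u r) {w : C2 N}
    (hw : (w : E N → ℝ) = fun x => u ‖x‖) : profile w = u := by
  ext r
  rw [profile, hw]
  simp only [PiLp.norm_single, Real.norm_eq_abs]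
  rcases abs_choice r with h | h <;> rw [h]
  exact heven r

theorem isOscillating_of_zeros {N : ℕ} [NeZero N] {u : ℝ → ℝ} {w : C2 N}
    (hw : (w : E N → ℝ) = fun x => u ‖x‖) (hz : ∀ R, ∃ r, R < r ∧ u r = 0) :
    IsOscillating w := by
  choose z hzR hz0 using fun k : ℕ => hz k
  have hnorm : ∀ k, ‖(EuclideanSpace.single (0 : Fin N) (z k) : E N)‖ = z k := fun k => by
    rw [PiLp.norm_single, Real.norm_eq_abs,
      abs_of_nonneg ((Nat.cast_nonneg k).trans (hzR k).le)]
  refine ⟨fun k => EuclideanSpace.single 0 (z k), fun k => ?_, fun hbd => ?_⟩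
  · rw [hw]
    simp only [hnorm, hz0]
  · obtain ⟨C, hC⟩ := hbd.exists_norm_le
    obtain ⟨k, hk⟩ := exists_nat_gt C
    have := hC _ (mem_range_self k)
    rw [hnorm] at this
    linarith [hzR k]

theorem isLocalized_of_tendsto {N : ℕ} {u : ℝ → ℝ} {w : C2 N}
    (hw : (w : E N → ℝ) = fun x => u ‖x‖) (h : Tendsto u atTop (𝓝 0)) : IsLocalized w := by
  rw [IsLocalized, hw]
  exact h.comp (tendsto_norm_cocompact_atTop (E := E N))

theorem exists_radial_family (n N : ℕ) {g : ℝ → ℝ} (hg : ContDiff ℝ 1 g)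
    (hodd : ∀ z, g (-z) = -g z) {α₀ : EReal}
    (hpos : ∀ z : ℝ, 0 < z → (z : EReal) < α₀ → 0 < g z) :
    ∃ (u : ℝ → ℝ → ℝ) (U : ℝ → C2 N), ∀ α : ℝ, ((|α| : ℝ) : EReal) < α₀ →
      IsRadialProfile n g α (u α) ∧ (∀ r, |u α r| ≤ |α|) ∧
      (U α : E N → ℝ) = fun x => u α ‖x‖ := by
  have : ∀ α : ℝ, ∃ (u : ℝ → ℝ) (U : C2 N), ((|α| : ℝ) : EReal) < α₀ →
      IsRadialProfile n g α u ∧ (∀ r, |u r| ≤ |α|) ∧ (U : E N → ℝ) = fun x => u ‖x‖ := by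
    intro α
    by_cases hα : ((|α| : ℝ) : EReal) < α₀
    · obtain ⟨u, hu, hb⟩ := exists_isRadialProfile_of_pos n hg hodd α
        fun z hz hzα => hpos z hz ((EReal.coe_le_coe_iff.2 hzα).trans_lt hα)
      exact ⟨u, ⟨_, hu.contDiff hg.continuous⟩, fun _ => ⟨hu, hb, rfl⟩⟩
    · exact ⟨0, ⟨fun _ => 0, contDiff_const⟩, fun h => absurd h hα⟩
  choose u U h using this
  exact ⟨u, U, h⟩

section Family

variable {n N : ℕ} {g : ℝ → ℝ} {α₀ : EReal} {u : ℝ → ℝ → ℝ} {U : ℝ → C2 N}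

theorem exists_local_c2_close (hg : ContDiff ℝ 1 g)
    (hU : ∀ α : ℝ, ((|α| : ℝ) : EReal) < α₀ → IsRadialProfile n g α (u α) ∧
      (∀ r, |u α r| ≤ |α|) ∧ (U α : E N → ℝ) = fun x => u α ‖x‖)
    {α : ℝ} (hα : ((|α| : ℝ) : EReal) < α₀) (R : ℝ) {ε : ℝ} (hε : 0 < ε) :
    ∃ δ > 0, ∀ β : ℝ, ((|β| : ℝ) : EReal) < α₀ → |β - α| < δ → ∀ x : E N, ‖x‖ ≤ R →
      |U β x - U α x| < ε ∧ ‖fderiv ℝ (U β) x - fderiv ℝ (U α) x‖ < ε ∧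
      ‖fderiv ℝ (fderiv ℝ (U β)) x - fderiv ℝ (fderiv ℝ (U α)) x‖ < ε := by
  obtain ⟨hu, huA, hUu⟩ := hU α hα
  obtain ⟨K, hK, hloc⟩ := IsRadialProfile.exists_local_bound n hg (|α| + 1) R
  refine ⟨min 1 (ε / (K + 1)), by positivity, fun β hβ hδ x hx => ?_⟩
  obtain ⟨hv, hvA, hUv⟩ := hU β hβ
  have hβα : |β| ≤ |α| + 1 := by
    have h1 : |β - α| < 1 := hδ.trans_le (min_le_left _ _)
    linarith [abs_sub_abs_le_abs_sub β α]
  have hKε : K * |β - α| < ε := by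
    have h1 := hδ.trans_le (min_le_right _ _)
    rw [lt_div_iff₀ (by positivity)] at h1
    nlinarith [abs_nonneg (β - α)]
  obtain ⟨h1, h2, h3⟩ := hloc hv hu (fun r => (hvA r).trans hβα)
    (fun r => (huA r).trans (by linarith)) ‖x‖ (norm_nonneg x) hx
  rw [hUu, hUv]
  refine ⟨h1.trans_lt hKε, ?_, ?_⟩
  · rw [hv.norm_fderiv_sub hu]
    exact h2.trans_lt hKε
  · exact (hv.norm_fderiv_fderiv_sub_le hu hg.continuous x).trans_lt (h3.trans_lt hKε)

theorem exists_uniform_c2_close (hg : ContDiff ℝ 1 g) (hodd : ∀ z, g (-z) = -g z)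
    (hg0 : g 0 = 0) (hder : 0 < deriv g 0)
    (hpos : ∀ z : ℝ, 0 < z → (z : EReal) < α₀ → 0 < g z) (hn : 1 ≤ n)
    (hU : ∀ α : ℝ, ((|α| : ℝ) : EReal) < α₀ → IsRadialProfile n g α (u α) ∧
      (∀ r, |u α r| ≤ |α|) ∧ (U α : E N → ℝ) = fun x => u α ‖x‖)
    {α : ℝ} (hα : ((|α| : ℝ) : EReal) < α₀) {ε : ℝ} (hε : 0 < ε) :
    ∃ δ > 0, ∀ β : ℝ, ((|β| : ℝ) : EReal) < α₀ → |β - α| < δ → ∀ x : E N,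
      |U β x - U α x| < ε ∧ ‖fderiv ℝ (U β) x - fderiv ℝ (U α) x‖ < ε ∧
      ‖fderiv ℝ (fderiv ℝ (U β)) x - fderiv ℝ (fderiv ℝ (U α)) x‖ < ε := by
  obtain ⟨hu, huA, hUu⟩ := hU α hα
  -- The room between `|α|` and `A` lets one pair `a`, `b` serve all nearby `β`.
  obtain ⟨A, hαA, hA⟩ := EReal.lt_iff_exists_real_btwn.1 hα
  have hαA : |α| < A := EReal.coe_lt_coe_iff.1 hαA
  obtain ⟨a, b, ha, hab, hbd⟩ := exists_linear_bounds hg hodd hder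
    ((abs_nonneg α).trans hαA.le)
    fun z hz hzA => hpos z hz ((EReal.coe_le_coe_iff.2 hzA).trans_lt hA)
  obtain ⟨R, δ₁, hδ₁, htail⟩ := hu.exists_tail_bound hg hodd hg0 hn ha hab hbd
    (fun r => (huA r).trans hαA.le) hε
  obtain ⟨δ₂, hδ₂, hloc⟩ := exists_local_c2_close hg hU hα R hε
  refine ⟨min (A - |α|) (min δ₁ δ₂), lt_min (by linarith) (lt_min hδ₁ hδ₂),
    fun β hβ hδ x => ?_⟩
  obtain ⟨hδA, hδ'⟩ := lt_min_iff.1 hδ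
  obtain ⟨hβ₁, hβ₂⟩ := lt_min_iff.1 hδ'
  rcases le_total ‖x‖ R with hx | hx
  · exact hloc β hβ hβ₂ x hx
  obtain ⟨hv, hvA, hUv⟩ := hU β hβ
  have hβA : |β| ≤ A := by linarith [abs_sub_abs_le_abs_sub β α]
  obtain ⟨h1, h2, h3⟩ := htail hv (fun r => (hvA r).trans hβA) hβ₁ ‖x‖ hx
  rw [hUu, hUv]
  refine ⟨h1, ?_, ?_⟩
  · rwa [hv.norm_fderiv_sub hu]
  · exact (hv.norm_fderiv_fderiv_sub_le hu hg.continuous x).trans_lt h3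

end Family

end Helmholtz

end

/-! ### The main theorem -/

theorem theorem1p1 (N : ℕ) [NeZero N] (σ : ℝ≥0) (hσ0 : 0 < σ) (hσ1 : σ < 1)
    (g : ℝ → ℝ) (hreg : Helmholtz.IsC1Holder σ g)
    (hodd : ∀ z, g (-z) = -g z)
    (hder : 0 < deriv g 0)
    (α₀ : EReal) (hα₀ : 0 < α₀)
    (hpos : ∀ z : ℝ, 0 < z → (z : EReal) < α₀ → 0 < g z)
    (hneg : ∀ z : ℝ, α₀ < (z : EReal) → g z < 0) :
    ∃ u : ℝ → Helmholtz.C2 N,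
      Helmholtz.IsLocallyUniformContinuum (u '' {α : ℝ | ((|α| : ℝ) : EReal) < α₀}) ∧
      (2 ≤ N → Helmholtz.IsUniformContinuum (u '' {α : ℝ | ((|α| : ℝ) : EReal) < α₀})) ∧
      ∀ α : ℝ, ((|α| : ℝ) : EReal) < α₀ →
        Helmholtz.IsRadial (u α) ∧
        Helmholtz.IsSolution g (u α) ∧
        Helmholtz.IsOscillating (u α) ∧
        u α 0 = α ∧
        eLpNorm (u α : Helmholtz.E N → ℝ) ∞ volume = ENNReal.ofReal |α| ∧
        eLpNorm (fun x : Helmholtz.E N => deriv (Helmholtz.profile (u α)) ‖x‖) ∞ volume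
          ≤ ENNReal.ofReal (Real.sqrt (2 * Helmholtz.primitive g α)) ∧
        (N = 1 → ∃ T : ℝ, 0 < T ∧ Function.Periodic (Helmholtz.profile (u α)) T) ∧
        (2 ≤ N →
          Helmholtz.IsLocalized (u α) ∧
          (α ≠ 0 → ∃ c C : ℝ, 0 < c ∧ 0 < C ∧ ∀ r : ℝ, 1 ≤ r →
            c * r ^ ((1 - (N : ℝ)) / 2) ≤
              |Helmholtz.profile (u α) r| + |deriv (Helmholtz.profile (u α)) r|
                + |deriv (deriv (Helmholtz.profile (u α))) r| ∧
            |Helmholtz.profile (u α) r| + |deriv (Helmholtz.profile (u α)) r|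
                + |deriv (deriv (Helmholtz.profile (u α))) r| ≤
              C * r ^ ((1 - (N : ℝ)) / 2))) := by
  obtain ⟨n, hN⟩ := Nat.exists_eq_succ_of_ne_zero (NeZero.ne N)
  have hg : ContDiff ℝ 1 g := hreg.1
  have hgc := hg.continuous
  have hg0 : g 0 = 0 := by
    have := hodd 0
    rw [neg_zero] at this
    linarith
  obtain ⟨u, U, hU⟩ := Helmholtz.exists_radial_family n N hg hodd hpos
  refine ⟨U, Helmholtz.isConnected_image_c2 hα₀ fun α hα K hK ε hε => ?_, fun hN2 =>
    Helmholtz.isConnected_image_c2 hα₀ fun α hα K hK ε hε => ?_, fun α hα => ?_⟩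
  · obtain ⟨R, hR⟩ := (show IsCompact K from hK).isBounded.exists_norm_le
    obtain ⟨δ, hδ, h⟩ := Helmholtz.exists_local_c2_close hg hU hα R hε
    exact ⟨δ, hδ, fun β hβ hβα x hx => h β hβ hβα x (hR x hx)⟩
  · obtain ⟨δ, hδ, h⟩ := Helmholtz.exists_uniform_c2_close hg hodd hg0 hder hpos
      (by omega) hU hα hε
    exact ⟨δ, hδ, fun β hβ hβα x _ => h β hβ hβα x⟩
  obtain ⟨hu, huα, hUu⟩ := hU α hα
  obtain ⟨a, b, ha, hab, hbd⟩ := Helmholtz.exists_linear_bounds hg hodd hder (abs_nonneg α)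
    fun z hz hzα => hpos z hz ((EReal.coe_le_coe_iff.2 hzα).trans_lt hα)
  have hosc := hu.isDampedOscillation hgc hodd ha hab hbd huα
  have hprof := Helmholtz.profile_eq hu.even hUu
  have hU0 : U α 0 = α := by
    rw [hUu]
    simp [hu.zero]
  rw [hprof]
  refine ⟨fun x y hxy => by simp only [hUu, hxy], fun x => ?_,
    Helmholtz.isOscillating_of_zeros hUu hosc.exists_zero, hU0, ?_, ?_, fun hN1 => ?_,
    fun hN2 => ⟨?_, fun hα0 => ?_⟩⟩
  · rw [hUu, hu.laplacian_eq hgc (by simp [hN]), neg_neg]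
  · exact Helmholtz.eLpNorm_top_eq_of_continuous (U α).2.continuous
      (fun x => by rw [hUu]; exact huα _) hU0
  · rw [eLpNorm_exponent_top]
    refine eLpNormEssSup_le_of_ae_bound (.of_forall fun x => Real.abs_le_sqrt ?_)
    have h1 := hu.energy_le hgc (norm_nonneg x)
    have h2 := (Helmholtz.primitive_bounds hgc hodd hbd (huα ‖x‖)).1
    have h3 : 0 ≤ a / 2 * u α ‖x‖ ^ 2 := by positivity
    linarith
  · obtain rfl : n = 0 := by omega
    obtain ⟨z, hz, hz0⟩ := hosc.exists_zero 0
    exact ⟨4 * z, by positivity, hu.periodic hg hodd huα hz0⟩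
  · refine Helmholtz.isLocalized_of_tendsto hUu ?_
    have h1 := (hosc.tendsto_energy (by omega)).const_mul (2 / a)
    rw [mul_zero] at h1
    have h2 : Tendsto (fun r => u α r ^ 2) atTop (𝓝 0) := by
      refine tendsto_of_tendsto_of_tendsto_of_le_of_le' tendsto_const_nhds h1
        (.of_forall fun r => sq_nonneg _) ?_
      filter_upwards [eventually_gt_atTop 0] with r hr using (hosc.energy_bounds hr).1
    rw [tendsto_zero_iff_abs_tendsto_zero]
    simpa [Function.comp_def, Real.sqrt_sq_eq_abs] using h2.sqrt
  · obtain ⟨C, hC, hH⟩ := Helmholtz.exists_holder_bound hreg hodd |α|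
    have hexp : (1 - (N : ℝ)) / 2 = -(n : ℝ) / 2 := by
      rw [hN]
      push_cast
      ring
    rw [hexp]
    have hGα : 0 < Helmholtz.primitive g α :=
      lt_of_lt_of_le (by positivity) (Helmholtz.primitive_bounds hgc hodd hbd le_rfl).1
    exact hu.exists_decay_bounds hgc hg0 hosc hGα (by omega) (NNReal.coe_pos.2 hσ0) hC
      fun r => hH _ (huα r)
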